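/- Let $\lambda_R,\lambda_S,\lambda_U>0$. In the plane consider roads forming a Poisson line process of intensity $\lambda_R$: writing a line as $\{z\in\mathbb R^2: z_1\cos\theta+z_2\sin\theta=p\}$, the pairs $(p,\theta)$ form a Poisson point process on $\mathbb R\times[0,\pi)$ with intensity measure $\lambda_R\,dp\,d\theta$ (so the number of roads hitting a disc of radius $x$ is Poisson with mean $2\pi\lambda_R x$). On each road place a one-dimensional homogeneous Poisson process of small cell base stations (SBSs) of intensity $\lambda_S$ and one of users of intensity $\lambda_U$, all of these being independent of each other and of the roads. An SBS is non-line-of-sight (NLOS) for a user if it does not lie on that user's road. The typical user is understood in the sense of the Palm distribution of the user process: for any Borel set $W\subset\mathbb R^2$ with $0<|W|<\infty$, the probability that a characteristic of the typical user lies in $A$ is the expected number of users in $W$ whose characteristic lies in $A$, divided by the expected number of users in $W$. Then the distance from the typical user to its nearest NLOS SBS has the probability density function $$f(x)=2\pi\lambda_R\exp\!\Big(-2\pi\lambda_R\Big(x-\int_0^x e^{-2\lambda_S\sqrt{x^2-r^2}}\,dr\Big)\Big)\;\Big[2\lambda_S x\int_0^x\frac{e^{-2\lambda_S\sqrt{x^2-r^2}}}{\sqrt{x^2-r^2}}\,dr\Big],\qquad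 x>0,$$ and $f(x)=0$ for $x\le 0$. The distance from the origin to the nearest SBS of the (stationary) Poisson line Cox process of all SBSs has the same density $f$. -/

import Mathlib

open MeasureTheory ProbabilityTheory Set
open scoped ENNReal NNReal

noncomputable section

/-- The counting measure `∑ₖ δ_{X k ω}` of the (enumerated) point process `X`. -/
def pointMeasure {Ω E : Type*} [MeasurableSpace E] (X : ℕ → Ω → E) (ω : Ω) : Measure E :=
  Measure.sum fun k => Measure.dirac (X k ω)

/-- The point process with points `X 0, X 1, X 2, …` is a Poisson point process with intensity
measure `m`: the number of points in a set `B` is Poisson distributed with mean `m B`, and the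
numbers of points in pairwise disjoint sets are independent. (All processes below have infinite
intensity measure, hence infinitely many points, so that an enumeration by `ℕ` exists.) -/
structure IsPoissonProcess {Ω E : Type*} [MeasurableSpace Ω] [MeasurableSpace E]
    (X : ℕ → Ω → E) (m : Measure E) (P : Measure Ω) : Prop where
  measurable : ∀ k, Measurable (X k)
  law : ∀ B : Set E, MeasurableSet B → m B ≠ ∞ →
    HasLaw (fun ω => pointMeasure X ω B)
      ((poissonMeasure (m B).toNNReal).map fun n : ℕ => (n : ℝ≥0∞)) P
  indep : ∀ (n : ℕ) (B : Fin n → Set E), (∀ j, MeasurableSet (B j)) →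
    (∀ i j, i ≠ j → Disjoint (B i) (B j)) →
    iIndepFun (fun j ω => pointMeasure X ω (B j)) P

/-- The Euclidean plane. -/
abbrev Plane : Type := EuclideanSpace ℝ (Fin 2)

/-- The pair `ℓ = (p, θ)` stands for the line `{z | z₀ cos θ + z₁ sin θ = p}`, and `linePoint ℓ t`
is the point of this line at signed arc length `t` from the foot of the perpendicular from the
origin. -/
def linePoint (ℓ : ℝ × ℝ) (t : ℝ) : Plane :=
  !₂[ℓ.1 * Real.cos ℓ.2 - t * Real.sin ℓ.2, ℓ.1 * Real.sin ℓ.2 + t * Real.cos ℓ.2]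

/-- The motion-invariant measure `dp dθ` on the space `ℝ × [0, π)` of lines. -/
def lineMeasure : Measure (ℝ × ℝ) :=
  (volume : Measure ℝ).prod ((volume : Measure ℝ).restrict (Ico 0 Real.pi))

/-- The Poisson line Cox model. The roads `road 0, road 1, …` form a Poisson line process with
intensity `lR`. For each `i`, `sbs i` and `user i` list the arc-length coordinates of the small
cell base stations and of the users on road `i`; they are one-dimensional homogeneous Poisson
processes of intensities `lS` and `lU`. All of these are independent of each other, and of the
roads. -/
structure IsRoadNetwork {Ω : Type*} [MeasurableSpace Ω] (P : Measure Ω)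
    (road : ℕ → Ω → ℝ × ℝ) (sbs user : ℕ → ℕ → Ω → ℝ) (lR lS lU : ℝ) : Prop where
  road_poisson : IsPoissonProcess road (ENNReal.ofReal lR • lineMeasure) P
  sbs_poisson : ∀ i, IsPoissonProcess (sbs i) (ENNReal.ofReal lS • (volume : Measure ℝ)) P
  user_poisson : ∀ i, IsPoissonProcess (user i) (ENNReal.ofReal lU • (volume : Measure ℝ)) P
  indep_marks : iIndepFun (fun (q : ℕ ⊕ ℕ) (ω : Ω) (k : ℕ) => Sum.elim sbs user q k ω) P
  indep_road : IndepFun (fun (ω : Ω) (i : ℕ) => road i ω)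
    (fun (ω : Ω) (q : ℕ ⊕ ℕ) (k : ℕ) => Sum.elim sbs user q k ω) P

/-- All base stations: the points of the Poisson line Cox process. -/
def coxPoints {Ω : Type*} (road : ℕ → Ω → ℝ × ℝ) (sbs : ℕ → ℕ → Ω → ℝ) (ω : Ω) : Set Plane :=
  {z | ∃ i k, z = linePoint (road i ω) (sbs i k ω)}

/-- The base stations that are non-line-of-sight for the users on road `j`: those on all the
other roads. -/
def nlosPoints {Ω : Type*} (road : ℕ → Ω → ℝ × ℝ) (sbs : ℕ → ℕ → Ω → ℝ) (j : ℕ) (ω : Ω) :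
    Set Plane :=
  {z | ∃ i k, i ≠ j ∧ z = linePoint (road i ω) (sbs i k ω)}

/-- The position of the `k`-th user on road `j`. -/
def userPos {Ω : Type*} (road : ℕ → Ω → ℝ × ℝ) (user : ℕ → ℕ → Ω → ℝ) (j k : ℕ) (ω : Ω) :
    Plane :=
  linePoint (road j ω) (user j k ω)

/-- The distance from the `k`-th user on road `j` to its nearest non-line-of-sight base station. -/
def nlosDist {Ω : Type*} (road : ℕ → Ω → ℝ × ℝ) (sbs user : ℕ → ℕ → Ω → ℝ) (j k : ℕ) (ω : Ω) :
    ℝ :=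
  Metric.infDist (userPos road user j k ω) (nlosPoints road sbs j ω)

/-- The law of a real characteristic `g j k` of the users, seen from the typical user, that is,
under the Palm distribution of the user process (observation window `W`):
`A ↦ E #{users in W with characteristic in A} / E #{users in W}`. -/
def typicalUserLaw {Ω : Type*} [MeasurableSpace Ω] (P : Measure Ω)
    (road : ℕ → Ω → ℝ × ℝ) (user : ℕ → ℕ → Ω → ℝ) (W : Set Plane) (g : ℕ → ℕ → Ω → ℝ) :
    Measure ℝ :=
  (∑' q : ℕ × ℕ, P {ω | userPos road user q.1 q.2 ω ∈ W})⁻¹ •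
    Measure.sum fun q : ℕ × ℕ =>
      (P.restrict {ω | userPos road user q.1 q.2 ω ∈ W}).map (g q.1 q.2)

/-- The density of the nearest distance. -/
def nearestPdf (lR lS x : ℝ) : ℝ :=
  if 0 < x then
    2 * Real.pi * lR *
      Real.exp (-(2 * Real.pi * lR *
        (x - ∫ r in (0 : ℝ)..x, Real.exp (-(2 * lS * Real.sqrt (x ^ 2 - r ^ 2)))))) *
      (2 * lS * x * ∫ r in (0 : ℝ)..x,
        Real.exp (-(2 * lS * Real.sqrt (x ^ 2 - r ^ 2))) / Real.sqrt (x ^ 2 - r ^ 2))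
  else 0

end

/-!
The distance is at least `x` exactly when no base station lies in the open disc of radius `x`. Given
the roads, the stations on different roads are independent, and a road `ℓ` has no station in the
disc with probability `e^{-2 lS h(ℓ)}`, where `h(ℓ)` is half the length of the chord that the disc
cuts out of `ℓ`. Hence the probability that the distance is at least `x` is the mean of
`e^{-Σᵢ 2 lS h(ℓᵢ)}` over the roads `ℓᵢ` (`measure_le_infDist_coxPoints`). The Laplace functional
of a Poisson process (`IsPoissonProcess.lintegral_negExp_tsum`) turns this mean into
`exp (-lR ∫ (1 - e^{-2 lS h}) dp dθ)`. A line at distance `|r| < x` from the centre has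
`h = √(x² - r²)`, so the exponent is `-2π lR (x - ∫₀ˣ e^{-2 lS √(x² - r²)} dr)`, wherever the
centre lies. Differentiation in `x`, after the substitution `r = x sin φ`, gives the density
(`lintegral_nearestPdf`).

For the typical user, the numerator of the Palm ratio is the sum, over all users, of the probability
that the user lies in `W` and has no station of another road within `x`. Given the roads and the
position of a user on road `j`, the second event has probability `e^{-Σ_{i ≠ j} 2 lS h(ℓᵢ)}`
(`measure_userPos_mem_le_nlosDist`). By the Mecke formula, removing road `j` from the Poisson
process of roads leaves a Poisson process with the same law, so the previous computation applies
and the sum over `j` factors (`tsum_measure_le_nlosDist`): the expected number of users in `W` times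
the same survival function.

The Mecke formula is needed only for functionals `e^{-Σ φ(ℓᵢ)}`. For a fixed `φ` it is the
derivative at `s = 0` of the Laplace functional of `φ + s 1_B`
(`IsPoissonProcess.lintegral_count_mul_negExp`). In the application `φ` depends on the position of
the user; this position is rounded to finitely many values. The value of the Mecke formula does not
depend on the rounding, by translation invariance of the measure on lines, and the rounding is
removed by dominated convergence (`tsum_lintegral_otherMass`).
-/

open Filter Topology

/-! ### The exponential `e^{-a}` on `[0, ∞]` -/

/-- `e^{-a}` for `a ∈ [0, ∞]`, with `e^{-∞} = 0`. -/
noncomputable def negExp (a : ℝ≥0∞) : ℝ≥0∞ := (EReal.exp (a : EReal))⁻¹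

lemma continuous_negExp : Continuous negExp :=
  continuous_inv.comp (EReal.expOrderIso.continuous.comp continuous_coe_ennreal_ereal)

@[fun_prop]
lemma measurable_negExp : Measurable negExp := continuous_negExp.measurable

@[simp] lemma negExp_zero : negExp 0 = 1 := by simp [negExp]

@[simp] lemma negExp_top : negExp ∞ = 0 := by simp [negExp]

lemma negExp_add (a b : ℝ≥0∞) : negExp (a + b) = negExp a * negExp b := by
  have h : ∀ a : ℝ≥0∞, EReal.exp (a : EReal) ≠ 0 := fun a => by
    simp [EReal.exp_eq_zero_iff]
  rw [negExp, EReal.coe_ennreal_add, EReal.exp_add, ENNReal.mul_inv (Or.inl (h a)) (Or.inr (h b))]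
  rfl

lemma negExp_antitone : Antitone negExp := fun a b h => by
  simpa [negExp] using h

lemma negExp_le_one (a : ℝ≥0∞) : negExp a ≤ 1 := negExp_zero ▸ negExp_antitone zero_le

lemma negExp_ne_top (a : ℝ≥0∞) : negExp a ≠ ∞ :=
  ((negExp_le_one a).trans_lt ENNReal.one_lt_top).ne

lemma negExp_ofReal {r : ℝ} (hr : 0 ≤ r) :
    negExp (ENNReal.ofReal r) = ENNReal.ofReal (Real.exp (-r)) := by
  rw [negExp, EReal.coe_ennreal_ofReal, max_eq_left hr, EReal.exp_coe, Real.exp_neg,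
    ENNReal.ofReal_inv_of_pos (Real.exp_pos r)]

lemma negExp_coe (r : ℝ≥0) : negExp r = ENNReal.ofReal (Real.exp (-r)) := by
  rw [← negExp_ofReal r.coe_nonneg, ENNReal.ofReal_coe_nnreal]

lemma negExp_ne_zero {a : ℝ≥0∞} (ha : a ≠ ∞) : negExp a ≠ 0 := by
  lift a to ℝ≥0 using ha
  simp [negExp_coe, Real.exp_pos]

lemma negExp_sum {ι : Type*} (s : Finset ι) (f : ι → ℝ≥0∞) :
    negExp (∑ i ∈ s, f i) = ∏ i ∈ s, negExp (f i) := by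
  classical
  induction s using Finset.induction_on with
  | empty => simp
  | insert i s hi ih => rw [Finset.sum_insert hi, Finset.prod_insert hi, negExp_add, ih]

lemma negExp_mul_nat (c : ℝ≥0∞) (n : ℕ) : negExp (c * n) = negExp c ^ n := by
  induction n with
  | zero => simp
  | succ n ih => rw [Nat.cast_succ, mul_add, mul_one, negExp_add, ih, pow_succ]

lemma tendsto_two_pow_mul_one_sub_exp {b : ℝ} {ε : ℕ → ℝ}
    (hε : Tendsto (fun n => 2 ^ n * ε n) atTop (𝓝 b)) :
    Tendsto (fun n => 2 ^ n * (1 - Real.exp (-ε n))) atTop (𝓝 b) := by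
  have h2 : Tendsto (fun n : ℕ => ((2 : ℝ) ^ n)⁻¹) atTop (𝓝 0) :=
    tendsto_inv_atTop_zero.comp (tendsto_pow_atTop_atTop_of_one_lt one_lt_two)
  have hε' : Tendsto ε atTop (𝓝 0) := by
    have := h2.mul hε
    simp only [zero_mul] at this
    refine this.congr fun n => ?_
    field_simp
  have hs := (Real.hasDerivAt_exp 0).isLittleO
  have hs' := hs.comp_tendsto (k := fun n => -ε n) (by simpa using hε'.neg)
  have hO : (fun n => (2 : ℝ) ^ n * ε n) =O[atTop] fun _ => (1 : ℝ) := hε.isBigO_one ℝ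
  have h3 : (fun n => (2 : ℝ) ^ n * (Real.exp (-ε n) - 1 + ε n)) =o[atTop]
      fun n => (2 : ℝ) ^ n * ε n := by
    refine (Asymptotics.isBigO_refl _ _).mul_isLittleO ?_
    simpa [Function.comp_def] using hs'
  have h4 := (h3.trans_isBigO hO).tendsto_inv_smul_nhds_zero
  simp only [inv_one, one_smul] at h4
  have h5 := hε.sub h4
  simp only [sub_zero] at h5
  refine h5.congr fun n => ?_
  ring

lemma tendsto_two_pow_mul_one_sub_negExp {b : ℝ} {ε : ℕ → ℝ}
    (hε : Tendsto (fun n => 2 ^ n * ε n) atTop (𝓝 b)) (hε0 : ∀ n, 0 ≤ ε n) :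
    Tendsto (fun n : ℕ => (2 : ℝ≥0∞) ^ n * (1 - negExp (ENNReal.ofReal (ε n)))) atTop
      (𝓝 (ENNReal.ofReal b)) := by
  refine (ENNReal.tendsto_ofReal (tendsto_two_pow_mul_one_sub_exp hε)).congr fun n => ?_
  rw [ENNReal.ofReal_mul (by positivity), ENNReal.ofReal_sub _ (Real.exp_pos _).le,
    negExp_ofReal (hε0 n), ENNReal.ofReal_pow (by norm_num)]
  simp

/-- The difference quotients `2ⁿ (1 - e^{-2⁻ⁿ a})` increase, by `1 - u² ≤ 2 (1 - u)`. -/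
lemma monotone_two_pow_mul_one_sub_negExp (a : ℝ≥0∞) :
    Monotone fun n : ℕ => (2 : ℝ≥0∞) ^ n * (1 - negExp (ENNReal.ofReal (2 ^ n)⁻¹ * a)) := by
  refine monotone_nat_of_le_succ fun n => ?_
  have h : ENNReal.ofReal (2 ^ n)⁻¹ * a =
      ENNReal.ofReal (2 ^ (n + 1))⁻¹ * a + ENNReal.ofReal (2 ^ (n + 1))⁻¹ * a := by
    rw [← add_mul, ← ENNReal.ofReal_add (by positivity) (by positivity)]
    congr 2
    rw [pow_succ]; field_simp; norm_num
  simp only [h, negExp_add]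
  have hu := negExp_le_one (ENNReal.ofReal (2 ^ (n + 1))⁻¹ * a)
  have hut := negExp_ne_top (ENNReal.ofReal (2 ^ (n + 1))⁻¹ * a)
  generalize negExp (ENNReal.ofReal (2 ^ (n + 1))⁻¹ * a) = u at hu hut
  rw [pow_succ, mul_assoc]
  gcongr
  lift u to ℝ≥0 using hut
  have hu' : u ≤ 1 := by exact_mod_cast hu
  have key : 1 - u * u ≤ 2 * (1 - u) := by
    rw [← NNReal.coe_le_coe]
    push_cast [NNReal.coe_sub hu', NNReal.coe_sub (mul_le_one' hu' hu')]
    nlinarith [sq_nonneg (1 - (u : ℝ))]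
  exact_mod_cast key

lemma tendsto_two_pow_mul_one_sub_negExp_mul {a : ℝ≥0∞} (ha : a ≠ ∞) :
    Tendsto (fun n : ℕ => (2 : ℝ≥0∞) ^ n * (1 - negExp (ENNReal.ofReal (2 ^ n)⁻¹ * a))) atTop
      (𝓝 a) := by
  have h := tendsto_two_pow_mul_one_sub_negExp (b := a.toReal)
    (ε := fun n => (2 ^ n)⁻¹ * a.toReal)
    (tendsto_const_nhds.congr fun n => by field_simp) fun n => by positivity
  rw [ENNReal.ofReal_toReal ha] at h
  refine h.congr fun n => ?_
  rw [ENNReal.ofReal_mul (by positivity), ENNReal.ofReal_toReal ha]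

lemma tendsto_two_pow_mul_one_sub_negExp_one_sub {a : ℝ≥0∞} (ha : a ≠ ∞) :
    Tendsto (fun n : ℕ => (2 : ℝ≥0∞) ^ n *
      (1 - negExp ((1 - negExp (ENNReal.ofReal (2 ^ n)⁻¹)) * a))) atTop (𝓝 a) := by
  have h1 := tendsto_two_pow_mul_one_sub_exp (b := 1) (ε := fun n => (2 ^ n)⁻¹)
    (tendsto_const_nhds.congr fun n => by field_simp)
  have h0 : ∀ n : ℕ, 0 ≤ 1 - Real.exp (-(2 ^ n)⁻¹) := fun n => by
    rw [sub_nonneg, Real.exp_le_one_iff]; simp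
  have h := tendsto_two_pow_mul_one_sub_negExp (b := a.toReal)
    (ε := fun n => (1 - Real.exp (-(2 ^ n)⁻¹)) * a.toReal)
    (by simpa [mul_assoc] using h1.mul_const a.toReal) fun n => mul_nonneg (h0 n) (by simp)
  rw [ENNReal.ofReal_toReal ha] at h
  refine h.congr fun n => ?_
  rw [ENNReal.ofReal_mul (h0 n), ENNReal.ofReal_toReal ha, ENNReal.ofReal_sub _ (by positivity),
    negExp_ofReal (by positivity), ENNReal.ofReal_one]

/-- The Laplace transform of the Poisson law. -/
lemma lintegral_negExp_poissonMeasure (r : ℝ≥0) (c : ℝ≥0∞) :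
    ∫⁻ n : ℕ, negExp (c * n) ∂(poissonMeasure r) = negExp ((1 - negExp c) * r) := by
  have hc : negExp c ≤ 1 := negExp_le_one c
  simp_rw [negExp_mul_nat]
  generalize hq : negExp c = q at hc
  have hqt : q ≠ ∞ := (hc.trans_lt ENNReal.one_lt_top).ne
  lift q to ℝ≥0 using hqt
  have hq1 : (q : ℝ) ≤ 1 := by exact_mod_cast hc
  have hsum : HasSum (fun n : ℕ => (q : ℝ) ^ n * (Real.exp (-r) * r ^ n / n.factorial))
      (Real.exp (-((1 - q) * r))) := by
    have h := (NormedSpace.expSeries_div_hasSum_exp ((q : ℝ) * r)).mul_left (Real.exp (-r))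
    rw [← Real.exp_eq_exp_ℝ, ← Real.exp_add] at h
    have h1 : -r + q * r = -((1 - q) * r : ℝ) := by ring
    have h2 : (fun n : ℕ => (q : ℝ) ^ n * (Real.exp (-r) * r ^ n / n.factorial)) =
        fun n => Real.exp (-r) * ((q * r : ℝ) ^ n / n.factorial) := by
      ext n; rw [mul_pow]; ring
    rwa [h2, ← h1]
  rw [lintegral_countable']
  have h1 : ∀ n : ℕ, (q : ℝ≥0∞) ^ n * poissonMeasure r {n} =
      ENNReal.ofReal ((q : ℝ) ^ n * (Real.exp (-r) * r ^ n / n.factorial)) := fun n => by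
    rw [poissonMeasure_singleton, ENNReal.ofReal_mul (by positivity),
      ENNReal.ofReal_pow q.coe_nonneg, ENNReal.ofReal_coe_nnreal]
  simp_rw [h1]
  rw [← ENNReal.ofReal_tsum_of_nonneg (fun n => by positivity) hsum.summable, hsum.tsum_eq,
    ← negExp_ofReal (mul_nonneg (sub_nonneg.2 hq1) r.coe_nonneg),
    ENNReal.ofReal_mul (sub_nonneg.2 hq1), ENNReal.ofReal_sub _ q.coe_nonneg]
  simp

/-! ### Poisson processes -/

section Poisson

variable {Ω E : Type*} [MeasurableSpace E] {X : ℕ → Ω → E}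

lemma lintegral_pointMeasure {φ : E → ℝ≥0∞} (hφ : Measurable φ) (ω : Ω) :
    ∫⁻ y, φ y ∂(pointMeasure X ω) = ∑' i, φ (X i ω) := by
  simp [pointMeasure, lintegral_sum_measure, lintegral_dirac' _ hφ]

lemma pointMeasure_apply {B : Set E} (hB : MeasurableSet B) (ω : Ω) :
    pointMeasure X ω B = ∑' i, B.indicator 1 (X i ω) := by
  rw [← lintegral_pointMeasure (measurable_one.indicator hB), lintegral_indicator_one hB]

namespace IsPoissonProcess

variable [MeasurableSpace Ω] {m : Measure E} {P : Measure Ω}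

lemma measurable_count (h : IsPoissonProcess X m P) {B : Set E} (hB : MeasurableSet B) :
    Measurable fun ω => pointMeasure X ω B := by
  simp_rw [pointMeasure_apply hB]
  exact Measurable.tsum fun i => (measurable_one.indicator hB).comp (h.measurable i)

lemma lintegral_negExp_count (h : IsPoissonProcess X m P) {B : Set E} (hB : MeasurableSet B)
    (hmB : m B ≠ ∞) (c : ℝ≥0∞) :
    ∫⁻ ω, negExp (c * pointMeasure X ω B) ∂P = negExp ((1 - negExp c) * m B) := by
  have hg : Measurable fun a : ℝ≥0∞ => negExp (c * a) := by fun_prop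
  rw [← lintegral_map (μ := P) hg (h.measurable_count hB), (h.law B hB hmB).map_eq,
    lintegral_map hg (measurable_from_top), lintegral_negExp_poissonMeasure,
    ENNReal.coe_toNNReal hmB]

lemma ae_count_lt_top (h : IsPoissonProcess X m P) {B : Set E} (hB : MeasurableSet B)
    (hmB : m B ≠ ∞) : ∀ᵐ ω ∂P, pointMeasure X ω B < ∞ := by
  rw [(h.law B hB hmB).ae_iff (p := fun a => a < ∞) (measurableSet_Iio.mem),
    ae_map_iff measurable_from_top.aemeasurable measurableSet_Iio]
  exact ae_of_all _ fun n => ENNReal.natCast_lt_top n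

/-- The joint Laplace transform of the counts of finitely many disjoint sets. -/
lemma lintegral_negExp_sum_count (h : IsPoissonProcess X m P) {ι : Type*} (s : Finset ι)
    {B : ι → Set E} (hB : ∀ i ∈ s, MeasurableSet (B i)) (hmB : ∀ i ∈ s, m (B i) ≠ ∞)
    (hd : (s : Set ι).PairwiseDisjoint B) (c : ι → ℝ≥0∞) :
    ∫⁻ ω, negExp (∑ i ∈ s, c i * pointMeasure X ω (B i)) ∂P =
      negExp (∑ i ∈ s, (1 - negExp (c i)) * m (B i)) := by
  let e := s.equivFin.symm
  have hs : ∀ f : ι → ℝ≥0∞, ∑ i ∈ s, f i = ∑ k, f (e k) := fun f => by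
    rw [Equiv.sum_comp e (fun i : s => f i), Finset.sum_coe_sort]
  simp_rw [hs, negExp_sum]
  have hind := h.indep _ (fun k => B (e k)) (fun k => hB _ (e k).2) fun i j hij =>
    hd (e i).2 (e j).2 fun hh => hij (e.injective (Subtype.ext hh))
  have hind' := hind.comp (fun k a => negExp (c (e k) * a)) fun k => by fun_prop
  have := lintegral_prod_eq_prod_lintegral_of_indepFun Finset.univ _ hind' fun k => by
    have := h.measurable_count (hB _ (e k).2)
    exact measurable_negExp.comp (this.const_mul _)
  simp only [Function.comp_apply] at this
  rw [this]
  exact Finset.prod_congr rfl fun k _ => h.lintegral_negExp_count (hB _ (e k).2) (hmB _ (e k).2) _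

/-- The Laplace functional of a Poisson process. -/
theorem lintegral_negExp_tsum (h : IsPoissonProcess X m P) [IsProbabilityMeasure P]
    {φ : E → ℝ≥0∞} (hφ : Measurable φ) (hs : m (Function.support φ) ≠ ∞) :
    ∫⁻ ω, negExp (∑' i, φ (X i ω)) ∂P = negExp (∫⁻ y, (1 - negExp (φ y)) ∂m) := by
  have simple : ∀ ψ : SimpleFunc E ℝ≥0∞, Function.support ψ ⊆ Function.support φ →
      ∫⁻ ω, negExp (∑' i, ψ (X i ω)) ∂P = negExp (∫⁻ y, (1 - negExp (ψ y)) ∂m) := by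
    intro ψ hψ
    have hsub : ∀ c ∈ ψ.range.filter (· ≠ 0), m (ψ ⁻¹' {c}) ≠ ∞ := fun c hc =>
      measure_ne_top_of_subset (fun y hy => hψ (by
        simp only [mem_preimage, mem_singleton_iff] at hy
        simpa [hy] using (Finset.mem_filter.1 hc).2)) hs
    have key := h.lintegral_negExp_sum_count (ψ.range.filter (· ≠ 0)) (B := fun c => ψ ⁻¹' {c})
      (fun c _ => ψ.measurableSet_fiber c) hsub
      (fun a _ b _ hab => Disjoint.preimage _ (by simpa using hab)) id
    convert key using 3 with ω
    · rw [← lintegral_pointMeasure ψ.measurable]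
      congr 1
      rw [SimpleFunc.lintegral_eq_lintegral]
      refine SimpleFunc.lintegral_eq_of_subset' _ fun c hc => ?_
      simpa using hc
    · have h1 : ∀ y, 1 - negExp (ψ y) = ψ.map (fun c => 1 - negExp c) y := fun y => rfl
      simp_rw [h1]
      rw [SimpleFunc.lintegral_eq_lintegral, SimpleFunc.map_lintegral]
      refine (Finset.sum_subset (Finset.filter_subset _ _) fun c hc hc' => ?_).symm
      have : c = 0 := by simpa [hc] using hc'
      simp [this]
  -- Both sides pass to the limit along an increasing sequence of simple functions.
  have hmono := SimpleFunc.monotone_eapprox φ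
  have hsupp : ∀ n, Function.support (SimpleFunc.eapprox φ n) ⊆ Function.support φ := by
    intro n y hy hy0
    refine hy (le_antisymm ?_ zero_le)
    rw [← hy0, ← SimpleFunc.iSup_eapprox_apply hφ y]
    exact le_iSup (fun n => SimpleFunc.eapprox φ n y) n
  have hL : Tendsto (fun n => ∫⁻ ω, negExp (∑' i, SimpleFunc.eapprox φ n (X i ω)) ∂P) atTop
      (𝓝 (∫⁻ ω, negExp (∑' i, φ (X i ω)) ∂P)) := by
    refine tendsto_lintegral_of_dominated_convergence (fun _ => 1) (fun n => ?_)
      (fun n => ae_of_all _ fun ω => negExp_le_one _) (by simp) (ae_of_all _ fun ω => ?_)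
    · have := fun i => h.measurable i
      fun_prop
    · refine (continuous_negExp.tendsto _).comp ?_
      simp_rw [← lintegral_pointMeasure (SimpleFunc.measurable _), ← lintegral_pointMeasure hφ]
      exact lintegral_tendsto_of_tendsto_of_monotone
        (fun n => (SimpleFunc.measurable _).aemeasurable)
        (ae_of_all _ fun y i j hij => hmono hij y)
        (ae_of_all _ fun y => SimpleFunc.tendsto_eapprox hφ y)
  have hR : Tendsto (fun n => negExp (∫⁻ y, (1 - negExp (SimpleFunc.eapprox φ n y)) ∂m)) atTop
      (𝓝 (negExp (∫⁻ y, (1 - negExp (φ y)) ∂m))) := by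
    refine (continuous_negExp.tendsto _).comp ?_
    refine lintegral_tendsto_of_tendsto_of_monotone
      (fun n => (by fun_prop : Measurable _).aemeasurable)
      (ae_of_all _ fun y i j hij => tsub_le_tsub_left (negExp_antitone (hmono hij y)) _)
      (ae_of_all _ fun y => ?_)
    exact ENNReal.Tendsto.sub tendsto_const_nhds
      ((continuous_negExp.tendsto _).comp (SimpleFunc.tendsto_eapprox hφ y)) (by simp)
  refine tendsto_nhds_unique hL (hR.congr fun n => (simple _ (hsupp n)).symm)

/-- The Laplace functional of the process weighted by the number of points in `B`: the derivative
of `s ↦ E e^{-Σ (φ + s 1_B)(X i)}` at `s = 0`, with the sign changed. -/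
theorem lintegral_count_mul_negExp (h : IsPoissonProcess X m P) [IsProbabilityMeasure P]
    {φ : E → ℝ≥0∞} (hφ : Measurable φ) (hs : m (Function.support φ) ≠ ∞)
    {B : Set E} (hB : MeasurableSet B) (hmB : m B ≠ ∞) :
    ∫⁻ ω, pointMeasure X ω B * negExp (∑' i, φ (X i ω)) ∂P =
      (∫⁻ y in B, negExp (φ y) ∂m) * negExp (∫⁻ y, (1 - negExp (φ y)) ∂m) := by
  set K := ∫⁻ y in B, negExp (φ y) ∂m with hK
  set L := ∫⁻ y, (1 - negExp (φ y)) ∂m with hL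
  have hKt : K ≠ ∞ := ((lintegral_mono fun y => negExp_le_one _).trans_lt
    (by simpa using hmB.lt_top)).ne
  -- The difference quotients are taken at the increments `2⁻ⁿ`, along which they increase.
  let s : ℕ → ℝ≥0∞ := fun n => ENNReal.ofReal (2 ^ n)⁻¹
  have hX := h.measurable
  have hN := h.measurable_count hB
  have hD : Measurable fun ω => negExp (∑' i, φ (X i ω)) := by fun_prop
  have hstep : ∀ n, ∫⁻ ω, 2 ^ n * (1 - negExp (s n * pointMeasure X ω B)) *
      negExp (∑' i, φ (X i ω)) ∂P = 2 ^ n * (1 - negExp ((1 - negExp (s n)) * K)) * negExp L := by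
    intro n
    have hφn : Measurable fun y => φ y + B.indicator (fun _ => s n) y :=
      hφ.add (measurable_const.indicator hB)
    have hsn : m (Function.support fun y => φ y + B.indicator (fun _ => s n) y) ≠ ∞ := by
      refine measure_ne_top_of_subset (s := Function.support φ ∪ B) (fun y hy => ?_)
        (measure_union_lt_top hs.lt_top hmB.lt_top).ne
      by_contra hc
      simp only [mem_union, Function.mem_support, not_or, not_not] at hc
      simp [hc] at hy
    have h1 := h.lintegral_negExp_tsum hφn hsn
    have h2 : ∀ ω, ∑' i, (φ (X i ω) + B.indicator (fun _ => s n) (X i ω)) =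
        ∑' i, φ (X i ω) + s n * pointMeasure X ω B := fun ω => by
      rw [ENNReal.tsum_add, pointMeasure_apply hB, ← ENNReal.tsum_mul_left]
      congr 1
      refine tsum_congr fun i => ?_
      by_cases hi : X i ω ∈ B <;> simp [hi]
    have h3 : ∫⁻ y, (1 - negExp (φ y + B.indicator (fun _ => s n) y)) ∂m =
        L + (1 - negExp (s n)) * K := by
      rw [hL, hK, ← lintegral_indicator hB, ← lintegral_const_mul _
        ((by fun_prop : Measurable fun y => negExp (φ y)).indicator hB),
        ← lintegral_add_left (by fun_prop)]
      congr 1; ext y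
      by_cases hy : y ∈ B
      · simp only [hy, indicator_of_mem, negExp_add]
        have ha := negExp_le_one (φ y)
        have hb := negExp_le_one (s n)
        have ha' := negExp_ne_top (φ y)
        have hb' := negExp_ne_top (s n)
        generalize negExp (φ y) = a at *
        generalize negExp (s n) = b at *
        lift a to ℝ≥0 using ha'
        lift b to ℝ≥0 using hb'
        have ha : a ≤ 1 := by exact_mod_cast ha
        have hb : b ≤ 1 := by exact_mod_cast hb
        have : 1 - a * b = 1 - a + (1 - b) * a := by
          rw [← NNReal.coe_inj]
          push_cast [NNReal.coe_sub ha, NNReal.coe_sub hb, NNReal.coe_sub (mul_le_one' ha hb)]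
          ring
        exact_mod_cast this
      · simp [hy]
    simp_rw [h2, h3, negExp_add] at h1
    have h4 : ∀ ω, 2 ^ n * (1 - negExp (s n * pointMeasure X ω B)) * negExp (∑' i, φ (X i ω)) =
        2 ^ n * (negExp (∑' i, φ (X i ω)) -
          negExp (∑' i, φ (X i ω)) * negExp (s n * pointMeasure X ω B)) := fun ω => by
      rw [mul_assoc, ENNReal.sub_mul fun _ _ => negExp_ne_top _, one_mul,
        mul_comm (negExp (s n * _))]
    simp_rw [h4]
    have hle : ∀ ω, negExp (∑' i, φ (X i ω)) * negExp (s n * pointMeasure X ω B) ≤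
        negExp (∑' i, φ (X i ω)) := fun ω => mul_le_of_le_one_right' (negExp_le_one _)
    rw [lintegral_const_mul _ (by fun_prop), lintegral_sub (by fun_prop) ?_ (ae_of_all _ hle), h1,
      h.lintegral_negExp_tsum hφ hs, mul_assoc, ENNReal.sub_mul fun _ _ => negExp_ne_top _, one_mul,
      mul_comm (negExp L)]
    rw [h1]
    exact ENNReal.mul_ne_top (negExp_ne_top _) (negExp_ne_top _)
  have hlim : Tendsto (fun n => ∫⁻ ω, 2 ^ n * (1 - negExp (s n * pointMeasure X ω B)) *
      negExp (∑' i, φ (X i ω)) ∂P) atTop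
      (𝓝 (∫⁻ ω, pointMeasure X ω B * negExp (∑' i, φ (X i ω)) ∂P)) := by
    refine lintegral_tendsto_of_tendsto_of_monotone
      (fun n => (by fun_prop : Measurable _).aemeasurable)
      (ae_of_all _ fun ω i j hij => mul_le_mul_left
        (monotone_two_pow_mul_one_sub_negExp (pointMeasure X ω B) hij) _) ?_
    filter_upwards [h.ae_count_lt_top hB hmB] with ω hω
    exact ENNReal.Tendsto.mul_const (tendsto_two_pow_mul_one_sub_negExp_mul hω.ne)
      (Or.inr (negExp_ne_top _))
  simp_rw [hstep] at hlim
  exact tendsto_nhds_unique hlim (ENNReal.Tendsto.mul_const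
    (tendsto_two_pow_mul_one_sub_negExp_one_sub hKt) (Or.inr (negExp_ne_top _)))

/-- The Mecke formula for a multiplicative functional of the other points. The value `∞` of `φ` is
excluded because the proof multiplies by `e^{φ}`. -/
theorem tsum_lintegral_mul_negExp (h : IsPoissonProcess X m P) [IsProbabilityMeasure P]
    [SigmaFinite m] {φ : E → ℝ≥0∞} (hφ : Measurable φ) (hs : m (Function.support φ) ≠ ∞)
    (hφt : ∀ y, φ y ≠ ∞) {g : E → ℝ≥0∞} (hg : Measurable g) :
    ∑' j, ∫⁻ ω, g (X j ω) * negExp (∑' i, if i = j then 0 else φ (X i ω)) ∂P =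
      (∫⁻ y, g y ∂m) * negExp (∫⁻ y, (1 - negExp (φ y)) ∂m) := by
  have hX := h.measurable
  have hD : Measurable fun ω => negExp (∑' i, φ (X i ω)) := by fun_prop
  set L := ∫⁻ y, (1 - negExp (φ y)) ∂m with hL
  have hμ : Measure.sum (fun j => (P.withDensity fun ω => negExp (∑' i, φ (X i ω))).map (X j)) =
      negExp L • m.withDensity fun y => negExp (φ y) := by
    refine (Measure.ext_iff_of_iUnion_eq_univ (iUnion_spanningSets m)).2 fun n => ?_
    ext B hB
    rw [Measure.restrict_apply hB, Measure.restrict_apply hB]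
    have hB' := hB.inter (measurableSet_spanningSets m n)
    generalize hC : B ∩ spanningSets m n = C at hB'
    have hmC : m C ≠ ∞ := by
      rw [← hC]
      exact measure_ne_top_of_subset inter_subset_right (measure_spanningSets_lt_top m n).ne
    rw [Measure.smul_apply, withDensity_apply _ hB', smul_eq_mul, mul_comm,
      ← h.lintegral_count_mul_negExp hφ hs hB' hmC, Measure.sum_apply _ hB']
    simp_rw [pointMeasure_apply hB', ← ENNReal.tsum_mul_right]
    have hm : ∀ i, Measurable fun ω =>
        C.indicator 1 (X i ω) * negExp (∑' i, φ (X i ω)) := fun i =>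
      ((measurable_one.indicator hB').comp (hX i)).mul hD
    rw [lintegral_tsum fun i => (hm i).aemeasurable]
    refine tsum_congr fun j => ?_
    rw [Measure.map_apply (hX j) hB', withDensity_apply _ (hX j hB'),
      ← lintegral_indicator (hX j hB')]
    congr 1; ext ω
    by_cases hω : X j ω ∈ C <;> simp [hω]
  -- Weighting point `j` by `e^{φ(X j)}` removes it from the sum in the exponent.
  have hinv : ∀ y, (negExp (φ y))⁻¹ * negExp (φ y) = 1 := fun y =>
    ENNReal.inv_mul_cancel (negExp_ne_zero (hφt y)) (negExp_ne_top _)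
  have hg' : Measurable fun y => g y * (negExp (φ y))⁻¹ := by fun_prop
  have key := congrArg (fun μ => ∫⁻ y, g y * (negExp (φ y))⁻¹ ∂μ) hμ
  simp only [lintegral_sum_measure, lintegral_smul_measure] at key
  rw [lintegral_withDensity_eq_lintegral_mul _ (by fun_prop) hg', smul_eq_mul, mul_comm] at key
  convert key using 1
  · refine tsum_congr fun j => ?_
    rw [lintegral_map hg' (hX j), lintegral_withDensity_eq_lintegral_mul _ hD
      (show Measurable fun ω => g (X j ω) * (negExp (φ (X j ω)))⁻¹ from hg'.comp (hX j))]
    congr 1; ext ω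
    simp only [Pi.mul_apply]
    rw [ENNReal.tsum_eq_add_tsum_ite (f := fun i => φ (X i ω)) j, negExp_add]
    calc _ = g (X j ω) * ((negExp (φ (X j ω)))⁻¹ * negExp (φ (X j ω))) *
        negExp (∑' i, if i = j then 0 else φ (X i ω)) := by rw [hinv, mul_one]
      _ = _ := by ring_nf
  · congr 2; ext y
    rw [Pi.mul_apply, mul_comm, mul_assoc, hinv, mul_one]

/-- The Campbell formula: `m` is the intensity measure of the process. -/
theorem sum_map_eq (h : IsPoissonProcess X m P) [IsProbabilityMeasure P] [SigmaFinite m] :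
    Measure.sum (fun k => P.map (X k)) = m := by
  ext B hB
  have key := h.tsum_lintegral_mul_negExp (φ := fun _ => 0) measurable_const (by simp) (by simp)
    (measurable_one.indicator hB)
  simp only [ite_self, tsum_zero, negExp_zero, mul_one, tsub_self, lintegral_zero,
    lintegral_indicator_one hB] at key
  rw [← key, Measure.sum_apply _ hB]
  refine tsum_congr fun k => ?_
  rw [← lintegral_map (measurable_one.indicator hB) (h.measurable k), lintegral_indicator_one hB]

end IsPoissonProcess
end Poisson

/-! ### Chords cut out of a line by a disc -/

/-- Signed coordinate of `z` along the unit normal `(cos θ, sin θ)`. -/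
noncomputable def normalCoord (z : Plane) (θ : ℝ) : ℝ := z 0 * Real.cos θ + z 1 * Real.sin θ

/-- Signed coordinate of `z` along the direction `(-sin θ, cos θ)` of the lines with angle `θ`. -/
noncomputable def tangentCoord (z : Plane) (θ : ℝ) : ℝ := -z 0 * Real.sin θ + z 1 * Real.cos θ

/-- Half the length of the chord that the disc of radius `x` about `z` cuts out of the line `ℓ`;
it is `0` for a line that misses the disc, since `√` vanishes on negative numbers. -/
noncomputable def halfChord (x : ℝ) (z : Plane) (ℓ : ℝ × ℝ) : ℝ :=
  √(x ^ 2 - (ℓ.1 - normalCoord z ℓ.2) ^ 2)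

/-- The part of the line `ℓ`, in arc length coordinates, in the open disc of radius `x` about
`z`. -/
noncomputable def chord (x : ℝ) (z : Plane) (ℓ : ℝ × ℝ) : Set ℝ :=
  Ioo (tangentCoord z ℓ.2 - halfChord x z ℓ) (tangentCoord z ℓ.2 + halfChord x z ℓ)

lemma dist_linePoint_sq (z : Plane) (ℓ : ℝ × ℝ) (t : ℝ) :
    dist z (linePoint ℓ t) ^ 2 =
      (ℓ.1 - normalCoord z ℓ.2) ^ 2 + (t - tangentCoord z ℓ.2) ^ 2 := by
  rw [EuclideanSpace.dist_eq, Real.sq_sqrt (by positivity)]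
  simp only [Fin.sum_univ_two, Real.dist_eq, sq_abs, linePoint, normalCoord, tangentCoord]
  simp only [Matrix.cons_val_zero, Matrix.cons_val_one]
  linear_combination (ℓ.1 ^ 2 + t ^ 2 - z 0 ^ 2 - z 1 ^ 2) * Real.sin_sq_add_cos_sq ℓ.2

lemma le_dist_linePoint_iff {x : ℝ} (hx : 0 ≤ x) (z : Plane) (ℓ : ℝ × ℝ) (t : ℝ) :
    x ≤ dist z (linePoint ℓ t) ↔ t ∉ chord x z ℓ := by
  have h : t ∈ chord x z ℓ ↔ |t - tangentCoord z ℓ.2| < halfChord x z ℓ := by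
    rw [chord, mem_Ioo, abs_lt]
    constructor <;> rintro ⟨h1, h2⟩ <;> constructor <;> linarith
  rw [h, not_lt, halfChord, Real.sqrt_le_iff, and_iff_right (abs_nonneg _), sq_abs,
    ← pow_le_pow_iff_left₀ hx dist_nonneg two_ne_zero, dist_linePoint_sq]
  constructor <;> intro h <;> linarith

lemma continuous_linePoint : Continuous fun q : (ℝ × ℝ) × ℝ => linePoint q.1 q.2 := by
  unfold linePoint
  fun_prop

lemma continuous_halfChord (x : ℝ) :
    Continuous fun q : Plane × ℝ × ℝ => halfChord x q.1 q.2 := by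
  unfold halfChord normalCoord
  fun_prop

/-! ### Void probabilities of the stations on given roads -/

lemma le_infDist_coxPoints_iff {Ω : Type*} {road : ℕ → Ω → ℝ × ℝ} {sbs : ℕ → ℕ → Ω → ℝ} (x : ℝ)
    (z : Plane) (ω : Ω) :
    x ≤ Metric.infDist z (coxPoints road sbs ω) ↔
      ∀ i k, x ≤ dist z (linePoint (road i ω) (sbs i k ω)) := by
  have hne : (coxPoints road sbs ω).Nonempty := ⟨_, 0, 0, rfl⟩
  rw [Metric.le_infDist hne]
  exact ⟨fun H i k => H ⟨i, k, rfl⟩, by rintro H _ ⟨i, k, rfl⟩; exact H i k⟩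

lemma le_nlosDist_iff {Ω : Type*} {road : ℕ → Ω → ℝ × ℝ} {sbs user : ℕ → ℕ → Ω → ℝ}
    (x : ℝ) (j k : ℕ) (ω : Ω) :
    x ≤ nlosDist road sbs user j k ω ↔
      ∀ i ≠ j, ∀ l, x ≤ dist (userPos road user j k ω) (linePoint (road i ω) (sbs i l ω)) := by
  have hne : (nlosPoints road sbs j ω).Nonempty := ⟨_, j + 1, 0, by omega, rfl⟩
  rw [nlosDist, Metric.le_infDist hne]
  exact ⟨fun H i hi l => H ⟨i, l, hi, rfl⟩, by rintro H _ ⟨i, l, hi, rfl⟩; exact H i hi l⟩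

section Marks

variable {Ω : Type*} [MeasurableSpace Ω] {P : Measure Ω}

lemma measure_forall_notMem {E : Type*} [MeasurableSpace E] {X : ℕ → Ω → E} {m : Measure E}
    (h : IsPoissonProcess X m P) {B : Set E} (hB : MeasurableSet B) (hmB : m B ≠ ∞) :
    P {ω | ∀ k, X k ω ∉ B} = negExp (m B) := by
  -- `e^{-∞ N}` is the indicator of `N = 0`.
  have key := h.lintegral_negExp_count hB hmB ∞
  rw [negExp_top, tsub_zero, one_mul] at key
  have hms : MeasurableSet {ω | ∀ k, X k ω ∉ B} := by
    rw [ofPred_forall]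
    exact MeasurableSet.iInter fun k => (h.measurable k hB).compl
  rw [← key, ← lintegral_indicator_one hms]
  congr 1; ext ω
  by_cases hω : ∀ k, X k ω ∉ B
  · rw [indicator_of_mem (by exact hω), pointMeasure_apply hB]
    simp [hω]
  · rw [indicator_of_notMem (by exact hω), ENNReal.top_mul, negExp_top]
    rw [pointMeasure_apply hB, Ne, ENNReal.tsum_eq_zero]
    push Not at hω ⊢
    obtain ⟨k, hk⟩ := hω
    exact ⟨k, by simp [hk]⟩

lemma measure_forall_forall_notMem [IsProbabilityMeasure P] {E : Type*} [MeasurableSpace E]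
    {X : ℕ → ℕ → Ω → E} {m : Measure E}
    (h : ∀ i, IsPoissonProcess (X i) m P) (hind : iIndepFun (fun i ω k => X i k ω) P)
    {B : ℕ → Set E} (hB : ∀ i, MeasurableSet (B i)) (hmB : ∀ i, m (B i) ≠ ∞) :
    P {ω | ∀ i k, X i k ω ∉ B i} = negExp (∑' i, m (B i)) := by
  let A : ℕ → Set (ℕ → E) := fun i => {s | ∀ k, s k ∉ B i}
  have hA : ∀ i, MeasurableSet (A i) := fun i => by
    simp only [A, ofPred_forall]
    exact MeasurableSet.iInter fun k => (measurable_pi_apply k (hB i)).compl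
  have hXm : ∀ i, Measurable fun ω k => X i k ω := fun i =>
    measurable_pi_lambda _ fun k => (h i).measurable k
  let C : ℕ → Set Ω := fun n => ⋂ i ∈ Finset.range n, (fun ω k => X i k ω) ⁻¹' A i
  have hC : ∀ n, P (C n) = negExp (∑ i ∈ Finset.range n, m (B i)) := fun n => by
    rw [hind.meas_biInter fun i _ => ⟨A i, hA i, rfl⟩, negExp_sum]
    exact Finset.prod_congr rfl fun i _ => measure_forall_notMem (h i) (hB i) (hmB i)
  have hI : {ω | ∀ i k, X i k ω ∉ B i} = ⋂ n, C n := by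
    ext ω
    simp only [mem_ofPred_eq, C, mem_iInter, Finset.mem_range, mem_preimage, A]
    exact ⟨fun H n i _ => H i, fun H i => H (i + 1) i (Nat.lt_succ_self i)⟩
  rw [hI]
  refine tendsto_nhds_unique (tendsto_measure_iInter_atTop (fun n => ?_) ?_
    ⟨0, measure_ne_top _ _⟩) ?_
  · exact (MeasurableSet.biInter (Finset.range n).countable_toSet
      fun i _ => hXm i (hA i)).nullMeasurableSet
  · intro a b hab
    exact biInter_subset_biInter_left fun i hi => by
      simp only [Finset.mem_coe, Finset.mem_range] at hi ⊢; omega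
  · simp only [Function.comp_def, hC]
    exact (continuous_negExp.tendsto _).comp (ENNReal.tendsto_nat_tsum _)

lemma measure_prodMk_mem_of_indepFun [IsProbabilityMeasure P] {α β : Type*} [MeasurableSpace α]
    [MeasurableSpace β] {f : Ω → α} {g : Ω → β} (hf : Measurable f) (hg : Measurable g)
    (h : IndepFun f g P) {D : Set (α × β)} (hD : MeasurableSet D) :
    P {ω | (f ω, g ω) ∈ D} = ∫⁻ ω, P {ω' | (f ω, g ω') ∈ D} ∂P := by
  have h1 := (indepFun_iff_map_prod_eq_prod_map_map hf.aemeasurable hg.aemeasurable).1 h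
  have h2 := congrArg (fun μ => μ D) h1
  have := Measure.isProbabilityMeasure_map (μ := P) hg.aemeasurable
  rw [Measure.map_apply (hf.prodMk hg) hD, Measure.prod_apply hD,
    lintegral_map (measurable_measure_prodMk_left hD) hf] at h2
  refine h2.trans (lintegral_congr fun ω => ?_)
  rw [Measure.map_apply hg (measurable_prodMk_left hD)]
  rfl

/-- The mean number of base stations, when the density on roads is `c`, on the part of the road `ℓ`
in the disc of radius `x` about `z`. -/
noncomputable def chordMass (c x : ℝ) (z : Plane) (ℓ : ℝ × ℝ) : ℝ≥0∞ :=
  ENNReal.ofReal (2 * c * halfChord x z ℓ)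

/-- The chord masses of the roads other than road `j`, for the disc of radius `x` about `z`. -/
noncomputable def otherMass {Ω : Type*} (road : ℕ → Ω → ℝ × ℝ) (c x : ℝ) (j : ℕ)
    (z : Plane) (ω : Ω) : ℝ≥0∞ :=
  ∑' i, if i = j then 0 else chordMass c x z (road i ω)

lemma continuous_chordMass (c x : ℝ) :
    Continuous fun q : Plane × ℝ × ℝ => chordMass c x q.1 q.2 := by
  unfold chordMass
  exact ENNReal.continuous_ofReal.comp (continuous_const.mul (continuous_halfChord x))

lemma measurable_chordMass (c x : ℝ) :
    Measurable fun q : Plane × ℝ × ℝ => chordMass c x q.1 q.2 :=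
  (continuous_chordMass c x).measurable

lemma smul_volume_chord {c : ℝ} (hc : 0 ≤ c) (x : ℝ) (z : Plane) (ℓ : ℝ × ℝ) :
    (ENNReal.ofReal c • (volume : Measure ℝ)) (chord x z ℓ) = chordMass c x z ℓ := by
  rw [Measure.smul_apply, chord, Real.volume_Ioo, smul_eq_mul, ← ENNReal.ofReal_mul hc, chordMass]
  congr 1; ring

variable {lR lS lU : ℝ} {road : ℕ → Ω → ℝ × ℝ}
  {sbs user : ℕ → ℕ → Ω → ℝ}

namespace IsRoadNetwork

lemma measurable_roads (hN : IsRoadNetwork P road sbs user lR lS lU) :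
    Measurable fun ω i => road i ω :=
  measurable_pi_lambda _ fun i => hN.road_poisson.measurable i

lemma measurable_sbs (hN : IsRoadNetwork P road sbs user lR lS lU) :
    Measurable fun ω i k => sbs i k ω :=
  measurable_pi_lambda _ fun i => measurable_pi_lambda _ fun k => (hN.sbs_poisson i).measurable k

lemma indepFun_user_sbs (hN : IsRoadNetwork P road sbs user lR lS lU) (j k : ℕ) :
    IndepFun (user j k) (fun ω i k => sbs i k ω) P := by
  have hle : ∀ q : ℕ ⊕ ℕ, MeasurableSpace.comap
      (fun (ω : Ω) (k : ℕ) => Sum.elim sbs user q k ω) inferInstance ≤ ‹MeasurableSpace Ω› := by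
    rintro (i | i)
    · exact (measurable_pi_lambda _ fun k => (hN.sbs_poisson i).measurable k).comap_le
    · exact (measurable_pi_lambda _ fun k => (hN.user_poisson i).measurable k).comap_le
  have h := indep_iSup_of_disjoint hle hN.indep_marks.iIndep
    (S := {Sum.inr j}) (T := range Sum.inl) (by simp)
  rw [IndepFun_iff_Indep]
  refine indep_of_indep_of_le_left (indep_of_indep_of_le_right h ?_) ?_
  · rw [← measurable_iff_comap_le]
    refine @measurable_pi_lambda _ _ _ (_) _ _ fun i => ?_
    rw [measurable_iff_comap_le]
    exact le_iSup₂_of_le (Sum.inl i) (mem_range_self i) le_rfl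
  · refine le_iSup₂_of_le (Sum.inr j) (mem_singleton _) ?_
    rw [← measurable_iff_comap_le]
    exact (measurable_pi_apply k).comp (comap_measurable fun (ω : Ω) (k : ℕ) => user j k ω)

variable [IsProbabilityMeasure P]

lemma measure_sbs_far (hN : IsRoadNetwork P road sbs user lR lS lU) (hS : 0 ≤ lS) {x : ℝ}
    (hx : 0 ≤ x) (I : Set ℕ) [DecidablePred (· ∈ I)] (z : Plane) (y : ℕ → ℝ × ℝ) :
    P {ω | ∀ i ∈ I, ∀ k, x ≤ dist z (linePoint (y i) (sbs i k ω))} =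
      negExp (∑' i, if i ∈ I then chordMass lS x z (y i) else 0) := by
  have hind : iIndepFun (fun i ω k => sbs i k ω) P :=
    hN.indep_marks.precomp (g := Sum.inl) Sum.inl_injective
  have h := measure_forall_forall_notMem (B := fun i => if i ∈ I then chord x z (y i) else ∅)
    hN.sbs_poisson hind (fun i => by split_ifs <;> simp [chord]) fun i => by
      split_ifs
      · rw [smul_volume_chord hS]; exact ENNReal.ofReal_ne_top
      · simp
  convert h using 3
  · ext ω
    refine forall_congr' fun i => ?_
    by_cases hi : i ∈ I <;> simp [hi, le_dist_linePoint_iff hx]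
  · ext i
    split_ifs
    · rw [smul_volume_chord hS]
    · simp

/-- The void probability of the Poisson line Cox process, in terms of the roads. -/
lemma measure_le_infDist_coxPoints (hN : IsRoadNetwork P road sbs user lR lS lU) (hS : 0 ≤ lS)
    {x : ℝ} (hx : 0 ≤ x) (z : Plane) :
    P {ω | x ≤ Metric.infDist z (coxPoints road sbs ω)} =
      ∫⁻ ω, negExp (∑' i, chordMass lS x z (road i ω)) ∂P := by
  have hind : IndepFun (fun ω i => road i ω) (fun ω i k => sbs i k ω) P :=
    hN.indep_road.comp (ψ := fun (f : ℕ ⊕ ℕ → ℕ → ℝ) i k => f (Sum.inl i) k)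
      measurable_id (by fun_prop)
  let D : Set ((ℕ → ℝ × ℝ) × (ℕ → ℕ → ℝ)) :=
    {q | ∀ i k, x ≤ dist z (linePoint (q.1 i) (q.2 i k))}
  have hD : MeasurableSet D := by
    simp only [D, ofPred_forall]
    refine MeasurableSet.iInter fun i => MeasurableSet.iInter fun k => ?_
    refine measurableSet_le measurable_const (Measurable.dist measurable_const ?_)
    exact continuous_linePoint.measurable.comp
      (f := fun q : (ℕ → ℝ × ℝ) × (ℕ → ℕ → ℝ) => (q.1 i, q.2 i k)) (by fun_prop)
  have h := measure_prodMk_mem_of_indepFun hN.measurable_roads hN.measurable_sbs hind hD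
  convert h using 2
  · ext ω
    simp only [D, mem_ofPred_eq, le_infDist_coxPoints_iff]
  · ext ω
    have := hN.measure_sbs_far hS hx univ z (fun i => road i ω)
    simpa [D] using this.symm

/-- The joint law of the position of a user and its nearest non-line-of-sight distance, in terms of
the roads and the position of the user on its road. -/
lemma measure_userPos_mem_le_nlosDist (hN : IsRoadNetwork P road sbs user lR lS lU) (hS : 0 ≤ lS)
    {x : ℝ} (hx : 0 ≤ x) {W : Set Plane} (hW : MeasurableSet W) (j k : ℕ) :
    P {ω | userPos road user j k ω ∈ W ∧ x ≤ nlosDist road sbs user j k ω} =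
      ∫⁻ ω, ∫⁻ t, W.indicator 1 (linePoint (road j ω) t) *
        negExp (otherMass road lS x j (linePoint (road j ω) t) ω) ∂(P.map (user j k)) ∂P := by
  have hind : IndepFun (fun ω i => road i ω) (fun ω => (user j k ω, fun i k => sbs i k ω)) P :=
    hN.indep_road.comp
      (ψ := fun (f : ℕ ⊕ ℕ → ℕ → ℝ) => (f (Sum.inr j) k, fun i k => f (Sum.inl i) k))
      measurable_id (by fun_prop)
  let D : Set ((ℕ → ℝ × ℝ) × ℝ × (ℕ → ℕ → ℝ)) :=
    {q | linePoint (q.1 j) q.2.1 ∈ W ∧ ∀ i ≠ j, ∀ l,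
      x ≤ dist (linePoint (q.1 j) q.2.1) (linePoint (q.1 i) (q.2.2 i l))}
  have hp : Measurable fun q : (ℕ → ℝ × ℝ) × ℝ × (ℕ → ℕ → ℝ) => linePoint (q.1 j) q.2.1 :=
    continuous_linePoint.measurable.comp
      (f := fun q : (ℕ → ℝ × ℝ) × ℝ × (ℕ → ℕ → ℝ) => (q.1 j, q.2.1)) (by fun_prop)
  have hD : MeasurableSet D := by
    simp only [D, ofPred_and, ofPred_forall]
    refine (hp hW).inter (MeasurableSet.iInter fun i => MeasurableSet.iInter fun _ =>
      MeasurableSet.iInter fun l => measurableSet_le measurable_const (hp.dist ?_))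
    exact continuous_linePoint.measurable.comp
      (f := fun q : (ℕ → ℝ × ℝ) × ℝ × (ℕ → ℕ → ℝ) => (q.1 i, q.2.2 i l)) (by fun_prop)
  have hu : Measurable (user j k) := (hN.user_poisson j).measurable k
  have h := measure_prodMk_mem_of_indepFun hN.measurable_roads (hu.prodMk hN.measurable_sbs) hind hD
  simp only [userPos]
  have h0 : {ω | linePoint (road j ω) (user j k ω) ∈ W ∧ x ≤ nlosDist road sbs user j k ω} =
      {ω | ((fun i => road i ω), user j k ω, fun i k => sbs i k ω) ∈ D} := by
    ext ω
    simp only [D, mem_ofPred_eq, le_nlosDist_iff, userPos]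
  rw [h0, h]
  refine lintegral_congr fun ω => ?_
  have h1 := measure_prodMk_mem_of_indepFun hu hN.measurable_sbs (hN.indepFun_user_sbs j k)
    (D := {q | ((fun i => road i ω), q) ∈ D}) (measurable_prodMk_left hD)
  have hF : ∀ t, P {ω' | ((fun i => road i ω), t, fun i k => sbs i k ω') ∈ D} =
      W.indicator 1 (linePoint (road j ω) t) *
        negExp (otherMass road lS x j (linePoint (road j ω) t) ω) := by
    intro t
    by_cases ht : linePoint (road j ω) t ∈ W
    · have := hN.measure_sbs_far hS hx {j}ᶜ (linePoint (road j ω) t) (fun i => road i ω)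
      simp only [mem_compl_iff, mem_singleton_iff, ite_not] at this
      simp [D, ht, this, otherMass]
    · simp [D, ht]
  have hFm : Measurable fun t => P {ω' | ((fun i => road i ω), t, fun i k => sbs i k ω') ∈ D} := by
    refine measurable_measure_prodMk_left (ν := P)
      (s := {q : ℝ × Ω | ((fun i => road i ω), q.1, fun i k => sbs i k q.2) ∈ D}) ?_
    exact hD.preimage (f := fun q : ℝ × Ω => ((fun i => road i ω), q.1, fun i k => sbs i k q.2))
      (measurable_const.prodMk (measurable_fst.prodMk (hN.measurable_sbs.comp measurable_snd)))
  simp only [mem_ofPred_eq] at h1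
  rw [h1, ← lintegral_map hFm hu]
  exact lintegral_congr hF

end IsRoadNetwork
end Marks

/-! ### The invariant measure on lines -/

lemma abs_normalCoord_le (z : Plane) (θ : ℝ) : |normalCoord z θ| ≤ |z 0| + |z 1| := by
  refine (abs_add_le _ _).trans (add_le_add ?_ ?_) <;> rw [abs_mul]
  · exact mul_le_of_le_one_right (abs_nonneg _) (Real.abs_cos_le_one θ)
  · exact mul_le_of_le_one_right (abs_nonneg _) (Real.abs_sin_le_one θ)

lemma chordMass_eq_zero (c : ℝ) {x : ℝ} (hx : 0 ≤ x) {z : Plane} {ℓ : ℝ × ℝ}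
    (h : x + (|z 0| + |z 1|) ≤ |ℓ.1|) : chordMass c x z ℓ = 0 := by
  have h1 : x ≤ |ℓ.1 - normalCoord z ℓ.2| := by
    have h2 := abs_normalCoord_le z ℓ.2
    have h3 := abs_sub_abs_le_abs_sub ℓ.1 (normalCoord z ℓ.2)
    linarith
  have h2 : x ^ 2 ≤ (ℓ.1 - normalCoord z ℓ.2) ^ 2 := by
    rw [← sq_abs (ℓ.1 - _)]
    gcongr
  rw [chordMass, halfChord, Real.sqrt_eq_zero_of_nonpos (by linarith)]
  simp

lemma lineMeasure_strip_ne_top (K : ℝ) : lineMeasure {ℓ | |ℓ.1| ≤ K} ≠ ∞ := by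
  have : {ℓ : ℝ × ℝ | |ℓ.1| ≤ K} = Icc (-K) K ×ˢ univ := by
    ext ℓ; simp [abs_le]
  rw [this, lineMeasure, Measure.prod_prod]
  exact ENNReal.mul_ne_top (by simp) (by simp)

lemma lineMeasure_support_chordMass_ne_top (c : ℝ) {x : ℝ} (hx : 0 ≤ x) (z : Plane) :
    lineMeasure (Function.support (chordMass c x z)) ≠ ∞ := by
  refine measure_ne_top_of_subset (fun ℓ hℓ => ?_)
    (lineMeasure_strip_ne_top (x + (|z 0| + |z 1|)))
  by_contra hc
  exact hℓ (chordMass_eq_zero c hx (not_le.1 hc).le)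

instance : SFinite lineMeasure := by unfold lineMeasure; infer_instance

instance : SigmaFinite lineMeasure := by unfold lineMeasure; infer_instance

/-- In coordinates adapted to the lines of angle `θ`, area is Lebesgue measure: these coordinates
differ from the standard ones by a rotation. -/
lemma measurePreserving_linePoint (θ : ℝ) :
    MeasurePreserving (fun q : ℝ × ℝ => linePoint (q.1, θ) q.2) := by
  let M : Matrix (Fin 2) (Fin 2) ℝ := !![Real.cos θ, -Real.sin θ; Real.sin θ, Real.cos θ]
  have hM : M.det = 1 := by
    rw [Matrix.det_fin_two_of]
    linear_combination Real.sin_sq_add_cos_sq θ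
  have h1 : MeasurePreserving (Matrix.toLin' M) :=
    ⟨(Matrix.toLin' M).continuous_of_finiteDimensional.measurable, by
      rw [Real.map_matrix_volume_pi_eq_smul_volume_pi (by rw [hM]; exact one_ne_zero)]
      simp [hM]⟩
  have h := ((PiLp.volume_preserving_toLp (Fin 2)).comp h1).comp
    (volume_preserving_finTwoArrow ℝ).symm
  have heq : (fun q : ℝ × ℝ => linePoint (q.1, θ) q.2) =
      (WithLp.toLp 2 ∘ Matrix.toLin' M) ∘ MeasurableEquiv.finTwoArrow.symm := by
    ext q i
    fin_cases i
    · simp [linePoint, M, MeasurableEquiv.finTwoArrow, Matrix.vecHead, Matrix.vecTail]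
      ring
    · simp [linePoint, M, MeasurableEquiv.finTwoArrow, Matrix.vecHead, Matrix.vecTail]
  rw [heq]
  exact h

/-- Points on lines, weighted by arc length and the invariant measure on lines, fill the plane with
constant density `π`. -/
lemma lintegral_lineMeasure_linePoint {W : Set Plane} (hW : MeasurableSet W) :
    ∫⁻ ℓ, (∫⁻ t, W.indicator 1 (linePoint ℓ t)) ∂lineMeasure =
      ENNReal.ofReal Real.pi * volume W := by
  have hm : Measurable fun q : (ℝ × ℝ) × ℝ =>
      W.indicator (1 : Plane → ℝ≥0∞) (linePoint q.1 q.2) :=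
    (measurable_one.indicator hW).comp continuous_linePoint.measurable
  rw [lineMeasure, lintegral_prod_symm _ hm.lintegral_prod_right'.aemeasurable]
  have h : ∀ θ, ∫⁻ p, ∫⁻ t, W.indicator (1 : Plane → ℝ≥0∞) (linePoint (p, θ) t) = volume W := by
    intro θ
    have hp := measurePreserving_linePoint θ
    rw [← lintegral_indicator_one hW, ← hp.lintegral_comp (measurable_one.indicator hW),
      Measure.volume_eq_prod, lintegral_prod]
    exact ((measurable_one.indicator hW).comp hp.measurable).aemeasurable
  simp_rw [h]
  simp [mul_comm]

lemma lintegral_one_sub_negExp_chord {c x : ℝ} (hc : 0 ≤ c) (hx : 0 ≤ x) :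
    ∫⁻ p, (1 - negExp (ENNReal.ofReal (2 * c * √(x ^ 2 - p ^ 2)))) =
      ENNReal.ofReal (2 * (x - ∫ r in (0 : ℝ)..x, Real.exp (-(2 * c * √(x ^ 2 - r ^ 2))))) := by
  let G : ℝ → ℝ := fun p => 1 - Real.exp (-(2 * c * √(x ^ 2 - p ^ 2)))
  have hG : Continuous G := by fun_prop
  have hG0 : ∀ p, 0 ≤ G p := fun p => by
    rw [sub_nonneg, Real.exp_le_one_iff, neg_nonpos]; positivity
  have h1 : ∀ p, 1 - negExp (ENNReal.ofReal (2 * c * √(x ^ 2 - p ^ 2))) =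
      (Ioc (-x) x).indicator (fun p => ENNReal.ofReal (G p)) p := by
    intro p
    rw [negExp_ofReal (by positivity), ← ENNReal.ofReal_one,
      ← ENNReal.ofReal_sub _ (Real.exp_pos _).le]
    by_cases hp : p ∈ Ioc (-x) x
    · rw [indicator_of_mem hp]
    · rw [indicator_of_notMem hp]
      have : x ^ 2 - p ^ 2 ≤ 0 := by
        rw [mem_Ioc, not_and_or, not_lt, not_le] at hp
        rcases hp with hp | hp <;> nlinarith
      rw [Real.sqrt_eq_zero_of_nonpos this]
      simp
  simp_rw [h1]
  rw [lintegral_indicator measurableSet_Ioc, ← ofReal_integral_eq_lintegral_ofReal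
    hG.integrableOn_Ioc (ae_of_all _ hG0), ← intervalIntegral.integral_of_le (by linarith)]
  congr 1
  have hi : ∀ a b, IntervalIntegrable G volume a b := fun a b => hG.intervalIntegrable a b
  have h2 : ∫ p in -x..0, G p = ∫ p in 0..x, G p := by
    have := intervalIntegral.integral_comp_neg (a := 0) (b := x) G
    rw [neg_zero] at this
    rw [← this]
    simp [G]
  rw [← intervalIntegral.integral_add_adjacent_intervals (hi _ 0) (hi _ _), h2,
    intervalIntegral.integral_sub (by simp) (Continuous.intervalIntegrable (by fun_prop) _ _)]
  simp
  ring

/-- The exponent of the Laplace functional of the roads. It does not depend on `z`, because line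
measure is invariant under translations. -/
lemma lintegral_one_sub_negExp_chordMass {c x : ℝ} (hc : 0 ≤ c) (hx : 0 ≤ x) (z : Plane) :
    ∫⁻ ℓ, (1 - negExp (chordMass c x z ℓ)) ∂lineMeasure =
      ENNReal.ofReal (2 * Real.pi *
        (x - ∫ r in (0 : ℝ)..x, Real.exp (-(2 * c * √(x ^ 2 - r ^ 2))))) := by
  have hm : Measurable fun ℓ => 1 - negExp (chordMass c x z ℓ) := by
    have : Measurable (chordMass c x z) :=
      ((continuous_chordMass c x).comp (Continuous.prodMk_right z)).measurable
    fun_prop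
  rw [lineMeasure, lintegral_prod_symm _ hm.aemeasurable]
  have h : ∀ θ, ∫⁻ p, (1 - negExp (chordMass c x z (p, θ))) =
      ENNReal.ofReal (2 * (x - ∫ r in (0 : ℝ)..x, Real.exp (-(2 * c * √(x ^ 2 - r ^ 2))))) := by
    intro θ
    rw [← lintegral_one_sub_negExp_chord hc hx]
    exact lintegral_sub_right_eq_self
      (fun p => 1 - negExp (ENNReal.ofReal (2 * c * √(x ^ 2 - p ^ 2)))) (normalCoord z θ)
  simp_rw [h]
  simp only [lintegral_const, MeasurableSet.univ, Measure.restrict_apply, univ_inter,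
    Real.volume_Ico, sub_zero]
  rw [mul_comm, ← ENNReal.ofReal_mul Real.pi_pos.le]
  congr 1; ring

/-! ### The density -/

section Density

open Real intervalIntegral

lemma sqrt_sq_sub_sq_mul_sin {x φ : ℝ} (hx : 0 ≤ x) (hφ : φ ∈ Icc 0 (π / 2)) :
    √(x ^ 2 - (x * sin φ) ^ 2) = x * cos φ := by
  have : x ^ 2 - (x * sin φ) ^ 2 = (x * cos φ) ^ 2 := by
    linear_combination (-x ^ 2) * sin_sq_add_cos_sq φ
  rw [this, sqrt_sq (mul_nonneg hx (cos_nonneg_of_mem_Icc ⟨by linarith [hφ.1, pi_pos], hφ.2⟩))]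

lemma integral_exp_neg_sqrt_eq (c : ℝ) {x : ℝ} (hx : 0 ≤ x) :
    ∫ r in (0 : ℝ)..x, exp (-(c * √(x ^ 2 - r ^ 2))) =
      x * ∫ φ in (0 : ℝ)..π / 2, exp (-(c * x * cos φ)) * cos φ := by
  have h := integral_comp_mul_deriv (a := 0) (b := π / 2) (f := fun φ => x * sin φ)
    (f' := fun φ => x * cos φ) (g := fun r => exp (-(c * √(x ^ 2 - r ^ 2))))
    (fun φ _ => (hasDerivAt_sin φ).const_mul x) (by fun_prop) (by fun_prop)
  simp only [Function.comp_apply, sin_zero, mul_zero, sin_pi_div_two, mul_one] at h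
  rw [← h, ← intervalIntegral.integral_const_mul]
  refine integral_congr fun φ hφ => ?_
  rw [uIcc_of_le (by positivity)] at hφ
  rw [sqrt_sq_sub_sq_mul_sin hx hφ]
  ring_nf

lemma integral_exp_neg_sqrt_div_eq (c : ℝ) {x : ℝ} (hx : 0 < x) :
    ∫ r in (0 : ℝ)..x, exp (-(c * √(x ^ 2 - r ^ 2))) / √(x ^ 2 - r ^ 2) =
      ∫ φ in (0 : ℝ)..π / 2, exp (-(c * x * cos φ)) := by
  have hsub : Ioo 0 (π / 2) ⊆ Icc (-(π / 2)) (π / 2) := fun φ hφ =>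
    ⟨by linarith [hφ.1, pi_pos], hφ.2.le⟩
  have himg : (fun φ => x * sin φ) '' Ioo 0 (π / 2) = Ioo 0 x := by
    ext r
    constructor
    · rintro ⟨φ, hφ, rfl⟩
      have h1 := sin_pos_of_pos_of_lt_pi hφ.1 (by linarith [hφ.2, pi_pos])
      have h2 : sin φ < 1 := by
        rw [← sin_pi_div_two]
        exact strictMonoOn_sin (hsub hφ) ⟨by linarith [pi_pos], le_rfl⟩ hφ.2
      exact ⟨by positivity, by nlinarith⟩
    · intro hr
      have h1 : 0 < r / x := div_pos hr.1 hx
      have h2 : r / x < 1 := (div_lt_one hx).2 hr.2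
      refine ⟨arcsin (r / x), ⟨arcsin_pos.2 h1, arcsin_lt_pi_div_two.2 h2⟩, ?_⟩
      simp only
      rw [sin_arcsin (by linarith) h2.le]
      field_simp
  have hinj : InjOn (fun φ => x * sin φ) (Ioo 0 (π / 2)) := fun a ha b hb hab =>
    injOn_sin (hsub ha) (hsub hb) (mul_left_cancel₀ hx.ne' hab)
  rw [integral_of_le hx.le, integral_of_le (by positivity), integral_Ioc_eq_integral_Ioo,
    integral_Ioc_eq_integral_Ioo, ← himg, integral_image_eq_integral_abs_deriv_smul
      measurableSet_Ioo (f' := fun φ => x * cos φ)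
      (fun φ _ => ((hasDerivAt_sin φ).const_mul x).hasDerivWithinAt) hinj]
  refine setIntegral_congr_fun measurableSet_Ioo fun φ hφ => ?_
  have hcos : 0 < cos φ := cos_pos_of_mem_Ioo ⟨by linarith [hφ.1, pi_pos], hφ.2⟩
  simp only [smul_eq_mul]
  rw [sqrt_sq_sub_sq_mul_sin hx.le (Ioo_subset_Icc_self hφ), abs_of_pos (by positivity)]
  field_simp

lemma hasDerivAt_integral_exp_mul_cos (c x : ℝ) :
    HasDerivAt (fun x => ∫ φ in (0 : ℝ)..π / 2, exp (-(c * x * cos φ)) * cos φ)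
      (∫ φ in (0 : ℝ)..π / 2, -c * (exp (-(c * x * cos φ)) * cos φ ^ 2)) x := by
  refine (intervalIntegral.hasDerivAt_integral_of_dominated_loc_of_deriv_le
    (F := fun x φ => exp (-(c * x * cos φ)) * cos φ)
    (F' := fun x φ => -c * (exp (-(c * x * cos φ)) * cos φ ^ 2)) (s := Metric.ball x 1)
    (bound := fun _ => |c| * exp (|c| * (|x| + 1)))
    (Metric.ball_mem_nhds x one_pos) (Eventually.of_forall fun y => ?_) ?_ ?_
    (ae_of_all _ fun φ _ y hy => ?_) ?_ (ae_of_all _ fun φ _ y _ => ?_)).2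
  · exact Continuous.aestronglyMeasurable (by fun_prop)
  · exact Continuous.intervalIntegrable (by fun_prop) _ _
  · exact Continuous.aestronglyMeasurable (by fun_prop)
  · have hy' : |y| ≤ |x| + 1 := by
      rw [Metric.mem_ball, dist_eq] at hy
      linarith [abs_sub_abs_le_abs_sub y x]
    have h1 : -(c * y * cos φ) ≤ |c| * (|x| + 1) := by
      refine (neg_le_abs _).trans ?_
      rw [abs_mul, abs_mul]
      calc _ ≤ |c| * |y| * 1 := by gcongr; exact abs_cos_le_one φ
        _ ≤ _ := by rw [mul_one]; gcongr
    rw [norm_mul, norm_neg, norm_mul, norm_pow, norm_eq_abs, norm_eq_abs, norm_eq_abs, abs_exp]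
    have h2 : |cos φ| ^ 2 ≤ 1 := pow_le_one₀ (abs_nonneg _) (abs_cos_le_one φ)
    calc _ ≤ |c| * (exp (|c| * (|x| + 1)) * 1) := by gcongr
      _ = _ := by rw [mul_one]
  · exact intervalIntegrable_const
  · have h := (((hasDerivAt_id y).const_mul c).mul_const (cos φ)).neg.exp.mul_const (cos φ)
    refine h.congr_deriv ?_
    simp only [id, mul_one, Pi.neg_apply]
    ring

/-- `φ ↦ sin φ e^{-a cos φ}` is an antiderivative of the integrand. -/
lemma integral_exp_neg_mul_cos_mul (a : ℝ) :
    ∫ φ in (0 : ℝ)..π / 2, exp (-(a * cos φ)) * (cos φ + a * sin φ ^ 2) = 1 := by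
  have h := integral_eq_sub_of_hasDerivAt (a := 0) (b := π / 2)
    (f := fun φ => sin φ * exp (-(a * cos φ)))
    (f' := fun φ => exp (-(a * cos φ)) * (cos φ + a * sin φ ^ 2)) (fun φ _ => by
      refine ((hasDerivAt_sin φ).mul (((hasDerivAt_cos φ).const_mul a).neg.exp)).congr_deriv ?_
      simp only [Pi.neg_apply]
      ring) (Continuous.intervalIntegrable (by fun_prop) _ _)
  rw [h]
  simp

lemma hasDerivAt_sub_mul_integral (c x : ℝ) :
    HasDerivAt (fun x => x - x * ∫ φ in (0 : ℝ)..π / 2, exp (-(c * x * cos φ)) * cos φ)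
      (c * x * ∫ φ in (0 : ℝ)..π / 2, exp (-(c * x * cos φ))) x := by
  have h := (hasDerivAt_id x).sub ((hasDerivAt_id x).mul (hasDerivAt_integral_exp_mul_cos c x))
  refine h.congr_deriv ?_
  have key := integral_exp_neg_mul_cos_mul (c * x)
  have hi : ∀ f : ℝ → ℝ, Continuous f → IntervalIntegrable f volume 0 (π / 2) :=
    fun f hf => hf.intervalIntegrable _ _
  simp only [id, one_mul]
  nth_rewrite 1 [← key]
  rw [← intervalIntegral.integral_const_mul, ← intervalIntegral.integral_const_mul,
    ← integral_add (hi _ (by fun_prop)) (hi _ (by fun_prop)),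
    ← integral_sub (hi _ (by fun_prop)) (hi _ (by fun_prop))]
  refine integral_congr fun φ _ => ?_
  linear_combination (c * x * exp (-(c * x * cos φ))) * sin_sq_add_cos_sq φ

/-- The probability that the distance is at least `x`, for `x ≥ 0`. -/
noncomputable def survival (lR lS x : ℝ) : ℝ :=
  exp (-(2 * π * lR * (x - ∫ r in (0 : ℝ)..x, exp (-(2 * lS * √(x ^ 2 - r ^ 2))))))

lemma survival_zero (lR lS : ℝ) : survival lR lS 0 = 1 := by simp [survival]

lemma nearestPdf_nonneg {lR lS : ℝ} (hR : 0 ≤ lR) (hS : 0 ≤ lS) (x : ℝ) :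
    0 ≤ nearestPdf lR lS x := by
  unfold nearestPdf
  split_ifs with hx
  · have : 0 ≤ ∫ r in (0 : ℝ)..x, exp (-(2 * lS * √(x ^ 2 - r ^ 2))) / √(x ^ 2 - r ^ 2) :=
      integral_nonneg hx.le fun r _ => by positivity
    positivity
  · exact le_rfl

lemma lintegral_nearestPdf {lR lS : ℝ} (hR : 0 ≤ lR) (hS : 0 ≤ lS) {a b : ℝ} (ha : 0 ≤ a)
    (hab : a ≤ b) :
    ∫⁻ x in Ico a b, ENNReal.ofReal (nearestPdf lR lS x) =
      ENNReal.ofReal (survival lR lS a - survival lR lS b) := by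
  let J : ℝ → ℝ := fun x => x - x * ∫ φ in (0 : ℝ)..π / 2, exp (-(2 * lS * x * cos φ)) * cos φ
  let H : ℝ → ℝ := fun x => ∫ φ in (0 : ℝ)..π / 2, exp (-(2 * lS * x * cos φ))
  let f : ℝ → ℝ := fun x => 2 * π * lR * exp (-(2 * π * lR * J x)) * (2 * lS * x * H x)
  have hJ : ∀ x, HasDerivAt J (2 * lS * x * H x) x := fun x => hasDerivAt_sub_mul_integral _ x
  have hJc : Continuous J := continuous_iff_continuousAt.2 fun x => (hJ x).continuousAt
  have hH : Continuous H := by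
    exact continuous_parametric_intervalIntegral_of_continuous' (by fun_prop) _ _
  have hf : Continuous f := by fun_prop
  have hsurv : ∀ x, 0 ≤ x → survival lR lS x = exp (-(2 * π * lR * J x)) := fun x hx => by
    rw [survival, integral_exp_neg_sqrt_eq _ hx]
  have hpdf : ∀ x, 0 ≤ x → nearestPdf lR lS x = f x := fun x hx => by
    rcases hx.eq_or_lt with rfl | hx
    · simp [nearestPdf, f]
    · simp only [nearestPdf, if_pos hx, f, H, J]
      rw [integral_exp_neg_sqrt_eq _ hx.le, integral_exp_neg_sqrt_div_eq _ hx]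
  have hftc : ∫ x in a..b, f x = survival lR lS a - survival lR lS b := by
    rw [integral_eq_sub_of_hasDerivAt (f := fun x => -exp (-(2 * π * lR * J x)))
      (fun x _ => ?_) (hf.intervalIntegrable _ _), hsurv a ha, hsurv b (ha.trans hab)]
    · ring
    · refine ((hJ x).const_mul (2 * π * lR)).neg.exp.neg.congr_deriv ?_
      simp only [Pi.neg_apply, f]
      ring
  rw [setLIntegral_congr_fun measurableSet_Ico (g := fun x => ENNReal.ofReal (f x))
    fun x hx => by simp only [hpdf x (ha.trans hx.1)], restrict_Ico_eq_restrict_Ioc,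
    ← ofReal_integral_eq_lintegral_ofReal hf.integrableOn_Ioc, ← integral_of_le hab, hftc]
  refine (ae_restrict_iff' measurableSet_Ioc).2 (ae_of_all _ fun x hx => ?_)
  rw [Pi.zero_apply, ← hpdf x (ha.trans hx.1.le)]
  exact nearestPdf_nonneg hR hS x

/-- A law on `[0, ∞)` with the right survival function has density `nearestPdf`. -/
lemma eq_withDensity_nearestPdf {lR lS : ℝ} (hR : 0 ≤ lR) (hS : 0 ≤ lS) {μ : Measure ℝ}
    [IsFiniteMeasure μ] (h0 : μ (Iio 0) = 0)
    (h : ∀ x, 0 ≤ x → μ (Ici x) = ENNReal.ofReal (survival lR lS x)) :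
    μ = volume.withDensity fun x => ENNReal.ofReal (nearestPdf lR lS x) := by
  have hcut : ∀ ρ : Measure ℝ, ρ (Iio 0) = 0 →
      ∀ a b : ℝ, ρ (Ico a b) = ρ (Ico (a ⊔ 0) (b ⊔ 0)) := by
    intro ρ hρ a b
    refine measure_congr ?_
    have hae : ∀ᵐ x ∂ρ, 0 ≤ x := by
      rw [ae_iff]; simp only [not_le]; exact hρ
    filter_upwards [hae] with x hx
    refine propext ⟨fun hm => ⟨sup_le hm.1 hx, lt_sup_of_lt_left hm.2⟩, fun hm => ⟨?_, ?_⟩⟩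
    · exact le_sup_left.trans hm.1
    · exact (lt_sup_iff.1 hm.2).resolve_right (not_lt.2 hx)
  refine Measure.ext_of_Ico _ _ fun a b _ => ?_
  have hν : volume.withDensity (fun x => ENNReal.ofReal (nearestPdf lR lS x)) (Iio 0) = 0 := by
    rw [withDensity_apply _ measurableSet_Iio, setLIntegral_congr_fun measurableSet_Iio
      (g := fun _ => 0) fun x hx => by simp [nearestPdf, not_lt.2 (le_of_lt (mem_Iio.1 hx))]]
    simp
  rw [hcut μ h0, hcut _ hν]
  rcases lt_or_ge (b ⊔ 0) (a ⊔ 0) with hlt | hle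
  · simp [Ico_eq_empty_of_le hlt.le]
  rw [withDensity_apply _ measurableSet_Ico, lintegral_nearestPdf hR hS le_sup_right hle,
    ← Ici_sdiff_Ici, measure_sdiff (Ici_subset_Ici.2 hle) measurableSet_Ici.nullMeasurableSet
    (measure_ne_top _ _), h _ le_sup_right, h _ le_sup_right,
    ENNReal.ofReal_sub _ (by unfold survival; positivity)]

end Density

/-! ### Averaging over the roads and the users -/

lemma negExp_lintegral_eq_survival {lR lS x : ℝ} (hR : 0 ≤ lR) (hS : 0 ≤ lS) (hx : 0 ≤ x)
    (z : Plane) :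
    negExp (∫⁻ ℓ, (1 - negExp (chordMass lS x z ℓ)) ∂(ENNReal.ofReal lR • lineMeasure)) =
      ENNReal.ofReal (survival lR lS x) := by
  have hI : ∫ r in (0 : ℝ)..x, Real.exp (-(2 * lS * √(x ^ 2 - r ^ 2))) ≤ x := by
    have h := intervalIntegral.integral_mono_on (μ := volume) hx
      (f := fun r => Real.exp (-(2 * lS * √(x ^ 2 - r ^ 2)))) (g := fun _ => 1)
      (Continuous.intervalIntegrable (by fun_prop) _ _) (by simp) fun r _ => by
        rw [Real.exp_le_one_iff, neg_nonpos]; positivity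
    simpa using h
  have hI' := sub_nonneg.2 hI
  rw [lintegral_smul_measure, lintegral_one_sub_negExp_chordMass hS hx, smul_eq_mul,
    ← ENNReal.ofReal_mul hR, negExp_ofReal (by positivity), survival]
  ring_nf

lemma continuous_otherMass {Ω : Type*} {road : ℕ → Ω → ℝ × ℝ} (c : ℝ) {x : ℝ} (hx : 0 ≤ x)
    (j : ℕ) {ω : Ω}
    (h : ∀ K : ℕ, {i | |(road i ω).1| ≤ K}.Finite) :
    Continuous fun z => otherMass road c x j z ω := by
  rw [continuous_iff_continuousAt]
  intro z
  obtain ⟨K, hK⟩ := exists_nat_gt (x + (|z 0| + |z 1|))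
  have hev : ∀ᶠ z' : Plane in 𝓝 z, x + (|z' 0| + |z' 1|) < K := by
    have hc : Continuous fun z' : Plane => x + (|z' 0| + |z' 1|) := by fun_prop
    exact hc.continuousAt.eventually_lt continuousAt_const hK
  have hsum : Continuous fun z' => ∑ i ∈ (h K).toFinset,
      if i = j then 0 else chordMass c x z' (road i ω) := by
    refine continuous_finsetSum _ fun i _ => ?_
    split_ifs
    · exact continuous_const
    · exact (continuous_chordMass c x).comp (Continuous.prodMk_left _)
  refine hsum.continuousAt.congr (hev.mono fun z' hz' => ?_)
  refine (tsum_eq_sum fun i hi => ?_).symm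
  rw [Finite.mem_toFinset, mem_ofPred_eq, not_le] at hi
  rw [chordMass_eq_zero c hx (hz'.trans hi).le, ite_self]

section Network

variable {Ω : Type*} [MeasurableSpace Ω] {P : Measure Ω} {lR lS lU : ℝ}
  {road : ℕ → Ω → ℝ × ℝ} {sbs user : ℕ → ℕ → Ω → ℝ}

namespace IsRoadNetwork

lemma measurable_otherMass {α : Type*} [MeasurableSpace α]
    (hN : IsRoadNetwork P road sbs user lR lS lU) (c x : ℝ) (j : ℕ) {f : α → Plane} {g : α → Ω}
    (hf : Measurable f) (hg : Measurable g) :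
    Measurable fun a => otherMass road c x j (f a) (g a) := by
  have hm : ∀ i, Measurable fun a => if i = j then 0 else chordMass c x (f a) (road i (g a)) := by
    intro i
    have hi : Measurable fun a => (f a, road i (g a)) :=
      hf.prodMk ((hN.road_poisson.measurable i).comp hg)
    by_cases hij : i = j
    · simp [hij]
    · simp only [hij, if_false]
      have h := (measurable_chordMass c x).comp hi
      simpa only [Function.comp_def] using h
  exact Measurable.tsum hm

lemma measurable_userPos (hN : IsRoadNetwork P road sbs user lR lS lU) (j k : ℕ) :
    Measurable (userPos road user j k) :=
  continuous_linePoint.measurable.comp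
    ((hN.road_poisson.measurable j).prodMk ((hN.user_poisson j).measurable k))

lemma measurable_sbsPos (hN : IsRoadNetwork P road sbs user lR lS lU) (i k : ℕ) :
    Measurable fun ω => linePoint (road i ω) (sbs i k ω) :=
  continuous_linePoint.measurable.comp
    ((hN.road_poisson.measurable i).prodMk ((hN.sbs_poisson i).measurable k))

lemma measurable_nlosDist (hN : IsRoadNetwork P road sbs user lR lS lU) (j k : ℕ) :
    Measurable (nlosDist road sbs user j k) := by
  refine measurable_of_Ici fun x => ?_
  have : nlosDist road sbs user j k ⁻¹' Ici x = ⋂ i, ⋂ (_ : i ≠ j), ⋂ l,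
      {ω | x ≤ dist (userPos road user j k ω) (linePoint (road i ω) (sbs i l ω))} := by
    ext ω
    simp only [mem_preimage, mem_Ici, le_nlosDist_iff, mem_iInter, mem_ofPred_eq]
  rw [this]
  exact MeasurableSet.iInter fun i => MeasurableSet.iInter fun _ => MeasurableSet.iInter fun l =>
    measurableSet_le measurable_const ((hN.measurable_userPos j k).dist (hN.measurable_sbsPos i l))

lemma measurable_infDist_coxPoints (hN : IsRoadNetwork P road sbs user lR lS lU) (z : Plane) :
    Measurable fun ω => Metric.infDist z (coxPoints road sbs ω) := by
  refine measurable_of_Ici fun x => ?_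
  have : (fun ω => Metric.infDist z (coxPoints road sbs ω)) ⁻¹' Ici x = ⋂ i, ⋂ k,
      {ω | x ≤ dist z (linePoint (road i ω) (sbs i k ω))} := by
    ext ω
    simp only [mem_preimage, mem_Ici, mem_iInter, mem_ofPred_eq, le_infDist_coxPoints_iff]
  rw [this]
  exact MeasurableSet.iInter fun i => MeasurableSet.iInter fun k =>
    measurableSet_le measurable_const (measurable_const.dist (hN.measurable_sbsPos i k))

/-- Almost surely only finitely many roads meet a given disc about the origin. -/
lemma ae_finite_roads (hN : IsRoadNetwork P road sbs user lR lS lU) :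
    ∀ᵐ ω ∂P, ∀ K : ℕ, {i | |(road i ω).1| ≤ K}.Finite := by
  rw [ae_all_iff]
  intro K
  have hB : MeasurableSet {ℓ : ℝ × ℝ | |ℓ.1| ≤ K} :=
    measurableSet_le (by fun_prop) measurable_const
  have hmB : (ENNReal.ofReal lR • lineMeasure) {ℓ : ℝ × ℝ | |ℓ.1| ≤ K} ≠ ∞ := by
    rw [Measure.smul_apply, smul_eq_mul]
    exact ENNReal.mul_ne_top ENNReal.ofReal_ne_top (lineMeasure_strip_ne_top K)
  filter_upwards [hN.road_poisson.ae_count_lt_top hB hmB] with ω hω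
  rw [pointMeasure_apply hB] at hω
  refine (ENNReal.finite_const_le_of_tsum_ne_top hω.ne one_ne_zero).subset fun i hi => ?_
  simp only [mem_ofPred_eq] at hi ⊢
  rw [indicator_of_mem (by exact hi)]
  rfl

variable [IsProbabilityMeasure P]

/-- The Mecke formula for the users in `W`, when the void probability of the other roads is
evaluated at a point that depends on the position of the user through a function with finitely many
values. -/
lemma tsum_lintegral_simpleFunc (hN : IsRoadNetwork P road sbs user lR lS lU) (hR : 0 ≤ lR)
    (hS : 0 ≤ lS) {x : ℝ} (hx : 0 ≤ x) {W : Set Plane} (hW : MeasurableSet W)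
    (ν : Measure ℝ) [SFinite ν] (r : SimpleFunc Plane Plane) :
    ∑' j, ∫⁻ ω, ∫⁻ t, W.indicator 1 (linePoint (road j ω) t) *
        negExp (otherMass road lS x j (r (linePoint (road j ω) t)) ω) ∂ν ∂P =
      (∫⁻ ℓ, ∫⁻ t, W.indicator 1 (linePoint ℓ t) ∂ν ∂(ENNReal.ofReal lR • lineMeasure)) *
        ENNReal.ofReal (survival lR lS x) := by
  have hX := hN.road_poisson.measurable
  let C : Plane → Set Plane := fun a => W ∩ r ⁻¹' {a}
  have hC : ∀ a, MeasurableSet (C a) := fun a => hW.inter (r.measurableSet_fiber a)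
  have hCm : ∀ a, Measurable fun q : (ℝ × ℝ) × ℝ =>
      (C a).indicator (1 : Plane → ℝ≥0∞) (linePoint q.1 q.2) := fun a =>
    (measurable_one.indicator (hC a)).comp continuous_linePoint.measurable
  let g : Plane → ℝ × ℝ → ℝ≥0∞ := fun a ℓ => ∫⁻ t, (C a).indicator 1 (linePoint ℓ t) ∂ν
  have hg : ∀ a, Measurable (g a) := fun a => (hCm a).lintegral_prod_right'
  have hsum : ∀ (u : Plane → ℝ≥0∞) (z : Plane),
      W.indicator 1 z * u (r z) = ∑ a ∈ r.range, (C a).indicator 1 z * u a := by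
    intro u z
    rw [Finset.sum_eq_single (r z)]
    · by_cases hz : z ∈ W <;> simp [C, hz]
    · intro b _ hb
      simp [C, hb.symm]
    · simp
  have hinner : ∀ j ω, ∫⁻ t, W.indicator 1 (linePoint (road j ω) t) *
        negExp (otherMass road lS x j (r (linePoint (road j ω) t)) ω) ∂ν =
      ∑ a ∈ r.range, g a (road j ω) * negExp (otherMass road lS x j a ω) := by
    intro j ω
    have hm : ∀ a, Measurable fun t => (C a).indicator (1 : Plane → ℝ≥0∞)
        (linePoint (road j ω) t) := fun a => (hCm a).comp measurable_prodMk_left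
    simp_rw [hsum fun a => negExp (otherMass road lS x j a ω)]
    rw [lintegral_finsetSum _ fun a _ => (hm a).mul_const _]
    exact Finset.sum_congr rfl fun a _ => lintegral_mul_const _ (hm a)
  have houter : ∀ j, ∫⁻ ω, ∑ a ∈ r.range, g a (road j ω) * negExp (otherMass road lS x j a ω) ∂P =
      ∑ a ∈ r.range, ∫⁻ ω, g a (road j ω) * negExp (otherMass road lS x j a ω) ∂P := fun j =>
    lintegral_finsetSum _ fun a _ => ((hg a).comp (hX j)).mul
      (measurable_negExp.comp (hN.measurable_otherMass lS x j measurable_const measurable_id))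
  simp_rw [hinner, houter]
  rw [Summable.tsum_finsetSum fun _ _ => ENNReal.summable]
  have hmecke : ∀ a, ∑' j, ∫⁻ ω, g a (road j ω) * negExp (otherMass road lS x j a ω) ∂P =
      (∫⁻ ℓ, g a ℓ ∂(ENNReal.ofReal lR • lineMeasure)) * ENNReal.ofReal (survival lR lS x) := by
    intro a
    rw [← negExp_lintegral_eq_survival hR hS hx a]
    have : SigmaFinite (ENNReal.ofReal lR • lineMeasure) := by
      have h : ENNReal.ofReal lR • lineMeasure = lR.toNNReal • lineMeasure := rfl
      rw [h]; infer_instance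
    refine hN.road_poisson.tsum_lintegral_mul_negExp
      ((continuous_chordMass lS x).comp (Continuous.prodMk_right a)).measurable ?_
      (fun _ => ENNReal.ofReal_ne_top) (hg a)
    rw [Measure.smul_apply, smul_eq_mul]
    exact ENNReal.mul_ne_top ENNReal.ofReal_ne_top
      (lineMeasure_support_chordMass_ne_top lS hx a)
  simp_rw [hmecke]
  rw [← Finset.sum_mul, ← lintegral_finsetSum _ fun a _ => hg a]
  congr 2; ext ℓ
  have hm : ∀ a ∈ r.range, Measurable fun t =>
      (C a).indicator (1 : Plane → ℝ≥0∞) (linePoint ℓ t) := fun a _ =>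
    (hCm a).comp measurable_prodMk_left
  simp only [g]
  rw [← lintegral_finsetSum _ hm]
  congr 1; ext t
  simpa using (hsum (fun _ => 1) (linePoint ℓ t)).symm

/-- The Mecke formula for the users in `W` and the void probability of the other roads. The position
of the user is rounded to finitely many values; the right-hand side does not depend on the rounding,
so dominated convergence gives the result. -/
lemma tsum_lintegral_otherMass (hN : IsRoadNetwork P road sbs user lR lS lU) (hR : 0 ≤ lR)
    (hS : 0 ≤ lS) {x : ℝ} (hx : 0 ≤ x) {W : Set Plane} (hW : MeasurableSet W)
    (ν : Measure ℝ) [SFinite ν]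
    (hfin : ∫⁻ ℓ, ∫⁻ t, W.indicator 1 (linePoint ℓ t) ∂ν ∂(ENNReal.ofReal lR • lineMeasure) ≠ ∞) :
    ∑' j, ∫⁻ ω, ∫⁻ t, W.indicator 1 (linePoint (road j ω) t) *
        negExp (otherMass road lS x j (linePoint (road j ω) t) ω) ∂ν ∂P =
      (∫⁻ ℓ, ∫⁻ t, W.indicator 1 (linePoint ℓ t) ∂ν ∂(ENNReal.ofReal lR • lineMeasure)) *
        ENNReal.ofReal (survival lR lS x) := by
  let Q : Measure (ℕ × Ω × ℝ) := Measure.count.prod (P.prod ν)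
  have hpos : Measurable fun q : ℕ × Ω × ℝ => linePoint (road q.1 q.2.1) q.2.2 :=
    measurable_from_prod_countable_right fun j => continuous_linePoint.measurable.comp
      (((hN.road_poisson.measurable j).comp measurable_fst).prodMk measurable_snd)
  have hWm : Measurable fun q : ℕ × Ω × ℝ =>
      W.indicator (1 : Plane → ℝ≥0∞) (linePoint (road q.1 q.2.1) q.2.2) :=
    (measurable_one.indicator hW).comp hpos
  let F : (Plane → Plane) → ℕ × Ω × ℝ → ℝ≥0∞ := fun r q =>
    W.indicator 1 (linePoint (road q.1 q.2.1) q.2.2) *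
      negExp (otherMass road lS x q.1 (r (linePoint (road q.1 q.2.1) q.2.2)) q.2.1)
  have hFm : ∀ r, Measurable r → Measurable (F r) := fun r hr =>
    measurable_from_prod_countable_right fun j =>
      ((hWm.comp (measurable_prodMk_left (x := j)))).mul (measurable_negExp.comp
        (hN.measurable_otherMass lS x j (hr.comp (hpos.comp (measurable_prodMk_left (x := j))))
          measurable_fst))
  have hQ : ∀ f : ℕ × Ω × ℝ → ℝ≥0∞, Measurable f →
      ∫⁻ q, f q ∂Q = ∑' j, ∫⁻ ω, ∫⁻ t, f (j, ω, t) ∂ν ∂P := fun f hf => by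
    rw [lintegral_prod _ hf.aemeasurable, lintegral_count]
    exact tsum_congr fun j => lintegral_prod _ (hf.comp measurable_prodMk_left).aemeasurable
  let r : ℕ → SimpleFunc Plane Plane := fun n =>
    SimpleFunc.nearestPt (TopologicalSpace.denseSeq Plane) n
  have hconst : ∀ n, ∫⁻ q, F (r n) q ∂Q = (∫⁻ ℓ, ∫⁻ t, W.indicator 1 (linePoint ℓ t) ∂ν
      ∂(ENNReal.ofReal lR • lineMeasure)) * ENNReal.ofReal (survival lR lS x) := fun n => by
    rw [hQ _ (hFm _ (r n).measurable)]
    exact hN.tsum_lintegral_simpleFunc hR hS hx hW ν (r n)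
  have hbound : ∫⁻ q : ℕ × Ω × ℝ, W.indicator 1 (linePoint (road q.1 q.2.1) q.2.2) ∂Q ≠ ∞ := by
    -- At radius `0` all chord masses vanish.
    have h := hN.tsum_lintegral_simpleFunc hR hS le_rfl hW ν (r 0)
    have h0 : ∀ j z ω, otherMass road lS 0 j z ω = 0 := fun j z ω => by
      have : ∀ ℓ, halfChord 0 z ℓ = 0 := fun ℓ =>
        Real.sqrt_eq_zero_of_nonpos (by nlinarith [sq_nonneg (ℓ.1 - normalCoord z ℓ.2)])
      simp [otherMass, chordMass, this]
    simp only [h0, negExp_zero, mul_one, survival_zero, ENNReal.ofReal_one] at h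
    rw [hQ _ hWm, h]
    exact hfin
  have hlim : Tendsto (fun n => ∫⁻ q, F (r n) q ∂Q) atTop (𝓝 (∫⁻ q, F id q ∂Q)) := by
    refine tendsto_lintegral_of_dominated_convergence _ (fun n => hFm _ (r n).measurable)
      (fun n => ae_of_all _ fun q => mul_le_of_le_one_right' (negExp_le_one _)) hbound ?_
    have hae : ∀ᵐ q ∂Q, ∀ K : ℕ, {i | |(road i q.2.1).1| ≤ K}.Finite :=
      Measure.quasiMeasurePreserving_snd.ae
        (Measure.quasiMeasurePreserving_fst.ae hN.ae_finite_roads)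
    filter_upwards [hae] with q hq
    have hr : Tendsto (fun n => r n (linePoint (road q.1 q.2.1) q.2.2)) atTop
        (𝓝 (linePoint (road q.1 q.2.1) q.2.2)) :=
      SimpleFunc.tendsto_nearestPt (by
        rw [(TopologicalSpace.denseRange_denseSeq Plane).closure_range]; trivial)
    refine ENNReal.Tendsto.const_mul ?_ (Or.inr ?_)
    · exact (continuous_negExp.tendsto _).comp
        (((continuous_otherMass lS hx q.1 hq).tendsto _).comp hr)
    · by_cases hz : linePoint (road q.1 q.2.1) q.2.2 ∈ W <;> simp [hz]
  simp_rw [hconst] at hlim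
  rw [tendsto_nhds_unique tendsto_const_nhds hlim, hQ _ (hFm _ measurable_id)]
  rfl

/-- The expected number of users in `W` at distance at least `x` from their nearest
non-line-of-sight base station. -/
theorem tsum_measure_le_nlosDist (hN : IsRoadNetwork P road sbs user lR lS lU) (hR : 0 ≤ lR)
    (hS : 0 ≤ lS) (hU : 0 ≤ lU) {x : ℝ} (hx : 0 ≤ x) {W : Set Plane} (hW : MeasurableSet W)
    (hWfin : volume W < ∞) :
    ∑' q : ℕ × ℕ, P {ω | userPos road user q.1 q.2 ω ∈ W ∧ x ≤ nlosDist road sbs user q.1 q.2 ω} =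
      ENNReal.ofReal (lR * lU * Real.pi) * volume W * ENNReal.ofReal (survival lR lS x) := by
  let ν : Measure ℝ := ENNReal.ofReal lU • volume
  have : SigmaFinite ν := by
    have h : ν = lU.toNNReal • (volume : Measure ℝ) := rfl
    rw [h]; infer_instance
  have hmass : ∫⁻ ℓ, ∫⁻ t, W.indicator 1 (linePoint ℓ t) ∂ν ∂(ENNReal.ofReal lR • lineMeasure) =
      ENNReal.ofReal (lR * lU * Real.pi) * volume W := by
    simp only [ν, lintegral_smul_measure, smul_eq_mul]
    rw [lintegral_const_mul' _ _ ENNReal.ofReal_ne_top, lintegral_lineMeasure_linePoint hW,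
      ENNReal.ofReal_mul (by positivity), ENNReal.ofReal_mul hR]
    ring
  have hcount : ∀ j, ∑' k,
      P {ω | userPos road user j k ω ∈ W ∧ x ≤ nlosDist road sbs user j k ω} =
      ∫⁻ ω, ∫⁻ t, W.indicator 1 (linePoint (road j ω) t) *
        negExp (otherMass road lS x j (linePoint (road j ω) t) ω) ∂ν ∂P := by
    intro j
    simp_rw [hN.measure_userPos_mem_le_nlosDist hS hx hW]
    have hpos : Measurable fun q : Ω × ℝ => linePoint (road j q.1) q.2 :=
      continuous_linePoint.measurable.comp
        (((hN.road_poisson.measurable j).comp measurable_fst).prodMk measurable_snd)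
    have hF : Measurable fun q : Ω × ℝ => W.indicator 1 (linePoint (road j q.1) q.2) *
        negExp (otherMass road lS x j (linePoint (road j q.1) q.2) q.1) :=
      ((measurable_one.indicator hW).comp hpos).mul
        (measurable_negExp.comp (hN.measurable_otherMass lS x j hpos measurable_fst))
    have hk : ∀ k, Measurable fun ω => ∫⁻ t, W.indicator 1 (linePoint (road j ω) t) *
        negExp (otherMass road lS x j (linePoint (road j ω) t) ω) ∂(P.map (user j k)) := fun k =>
      hF.lintegral_prod_right'
    rw [← lintegral_tsum fun k => (hk k).aemeasurable]
    refine lintegral_congr fun ω => ?_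
    rw [← lintegral_sum_measure, (hN.user_poisson j).sum_map_eq]
  rw [ENNReal.tsum_prod (f := fun j k => P {ω | userPos road user j k ω ∈ W ∧
    x ≤ nlosDist road sbs user j k ω})]
  simp_rw [hcount]
  rw [hN.tsum_lintegral_otherMass hR hS hx hW ν, hmass]
  rw [hmass]
  exact ENNReal.mul_ne_top ENNReal.ofReal_ne_top hWfin.ne

end IsRoadNetwork

end Network

theorem mainTheorem4 {Ω : Type*} [MeasurableSpace Ω] (P : Measure Ω) [IsProbabilityMeasure P]
    (lR lS lU : ℝ) (hR : 0 < lR) (hS : 0 < lS) (hU : 0 < lU)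
    (road : ℕ → Ω → ℝ × ℝ) (sbs user : ℕ → ℕ → Ω → ℝ)
    (hN : IsRoadNetwork P road sbs user lR lS lU) :
    (∀ W : Set Plane, MeasurableSet W → 0 < volume W → volume W < ∞ →
      typicalUserLaw P road user W (nlosDist road sbs user) =
        (volume : Measure ℝ).withDensity fun x => ENNReal.ofReal (nearestPdf lR lS x)) ∧
    HasLaw (fun ω => Metric.infDist (0 : Plane) (coxPoints road sbs ω))
      ((volume : Measure ℝ).withDensity fun x => ENNReal.ofReal (nearestPdf lR lS x)) P := by
  constructor
  · intro W hW hW0 hWt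
    have hcount := fun (x : ℝ) (hx : 0 ≤ x) =>
      hN.tsum_measure_le_nlosDist hR.le hS.le hU.le hx hW hWt
    have hnn : ∀ j k ω, 0 ≤ nlosDist road sbs user j k ω := fun j k ω => Metric.infDist_nonneg
    set c := ENNReal.ofReal (lR * lU * Real.pi) * volume W
    have hc0 : c ≠ 0 := mul_ne_zero (by simpa using by positivity) hW0.ne'
    have hct : c ≠ ∞ := ENNReal.mul_ne_top ENNReal.ofReal_ne_top hWt.ne
    have htotal : ∑' q : ℕ × ℕ, P {ω | userPos road user q.1 q.2 ω ∈ W} = c := by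
      have h := hcount 0 le_rfl
      simpa only [hnn, and_true, survival_zero, ENNReal.ofReal_one, mul_one] using h
    have happly : ∀ A, MeasurableSet A → typicalUserLaw P road user W (nlosDist road sbs user) A =
        c⁻¹ * ∑' q : ℕ × ℕ,
          P {ω | userPos road user q.1 q.2 ω ∈ W ∧ nlosDist road sbs user q.1 q.2 ω ∈ A} := by
      intro A hA
      rw [typicalUserLaw, htotal, Measure.smul_apply, Measure.sum_apply _ hA, smul_eq_mul]
      congr 1
      refine tsum_congr fun q => ?_
      have hm := hN.measurable_nlosDist q.1 q.2
      rw [Measure.map_apply hm hA, Measure.restrict_apply (hm hA), inter_comm]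
      rfl
    have hIci : ∀ x, 0 ≤ x → typicalUserLaw P road user W (nlosDist road sbs user) (Ici x) =
        ENNReal.ofReal (survival lR lS x) := by
      intro x hx
      rw [happly _ measurableSet_Ici]
      simp only [mem_Ici]
      rw [hcount x hx, ← mul_assoc, ENNReal.inv_mul_cancel hc0 hct, one_mul]
    have hIio : typicalUserLaw P road user W (nlosDist road sbs user) (Iio 0) = 0 := by
      rw [happly _ measurableSet_Iio]
      simp [(hnn _ _ _).not_gt]
    have : IsFiniteMeasure (typicalUserLaw P road user W (nlosDist road sbs user)) := by
      refine ⟨?_⟩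
      rw [← Iio_union_Ici (a := (0 : ℝ))]
      refine (measure_union_le _ _).trans_lt ?_
      rw [hIio, hIci 0 le_rfl, zero_add]
      exact ENNReal.ofReal_lt_top
    exact eq_withDensity_nearestPdf hR.le hS.le hIio hIci
  · have hm := hN.measurable_infDist_coxPoints 0
    refine ⟨hm.aemeasurable, ?_⟩
    have := Measure.isProbabilityMeasure_map (μ := P) hm.aemeasurable
    refine eq_withDensity_nearestPdf hR.le hS.le ?_ fun x hx => ?_
    · rw [Measure.map_apply hm measurableSet_Iio]
      have : (fun ω => Metric.infDist (0 : Plane) (coxPoints road sbs ω)) ⁻¹' Iio 0 = ∅ := by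
        ext ω
        simp [Metric.infDist_nonneg.not_gt]
      rw [this, measure_empty]
    · rw [Measure.map_apply hm measurableSet_Ici,
        ← negExp_lintegral_eq_survival hR.le hS.le hx 0, ← hN.road_poisson.lintegral_negExp_tsum,
        ← hN.measure_le_infDist_coxPoints hS.le hx]
      · rfl
      · exact ((continuous_chordMass lS x).comp (Continuous.prodMk_right 0)).measurable
      · rw [Measure.smul_apply, smul_eq_mul]
        exact ENNReal.mul_ne_top ENNReal.ofReal_ne_top
          (lineMeasure_support_chordMass_ne_top lS hx 0)
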